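/- Let $[m]=(q^m-q^{-m})/(q-q^{-1})\in\mathbb{C}(q)$. For $n\ge 0$ let $\mathrm{TL}^D_{n+1}$ be the Temperley--Lieb algebra of type $D_{n+1}$: the $\mathbb{C}(q)$-algebra with generators $E_0,\dots,E_n$ and relations $E_i^2=-[2]E_i$; $E_iE_jE_i=E_i$ if $i,j$ are adjacent in the Dynkin diagram; $E_iE_j=E_jE_i$ otherwise. Here the edges of the Dynkin diagram are $0-2$ and $k-(k+1)$ for $1\le k\le n-1$. For $m\le n$ we map $\mathrm{TL}^D_{m+1}\to\mathrm{TL}^D_{n+1}$ by $E_i\mapsto E_i$. There is exactly one family $(Q_n)_{n\ge0}$ with $Q_n\in \mathrm{TL}^D_{n+1}$, $Q_n\ne0$, $Q_nQ_i=Q_iQ_n=Q_n$ for $0\le i\le n$, and $E_iQ_n=Q_nE_i=0$ for $0\le i\le n$ (the Jones--Wenzl projections of type $D$). A word $w=(s_1,\dots,s_l)$ is reduced if $E_w:=E_{s_1}\cdots E_{s_l}$ is not a scalar multiple of the element of a shorter word. An even $(n+1)$-strand diagram is a non-crossing perfect pairing of $n+1$ top and $n+1$ bottom points by cups (top--top),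 caps (bottom--bottom) and vertical strands (top--bottom), with at most one dot on each strand and an even number of dots in total, such that every dot is on the left-most vertical strand, or on a cap or a cup that has no larger one around it and no vertical strand to its left. The diagram of $E_i$, $i\ge1$, has a cup and a cap joining the $i$-th and the $(i+1)$-th points and vertical strands elsewhere; that of $E_0$ is the one of $E_1$ with a dot on the cup and a dot on the cap. An even diagram $D$ is the diagram of a reduced word $w$ if it is obtained by stacking the diagrams of the generators of $w$ from top to bottom, without closed loops arising (two dots on a strand cancel). Write $\mathrm{coef}_n(D)$ for the coefficient of an even $(n+1)$-strand diagram $D$ in $Q_n$, that is, the coefficient of $E_w$, where $w$ is a reduced word with diagram $D$, when $Q_n$ is written as a linear combination of the distinct elements $E_{w'}$, $w'$ reduced. This coefficient exists and depends only on $D$. An inner-most cap at position $i$, $1\le i\le n$, is a cap joining the $i$-th and the $(i+1)$-th bottom points; a vertical strand joining the right-most bottom and the right-most top point also counts as an inner-most cap, at position $n+1$. Let $I^\circ(D)$ be the set of positions of inner-most caps without a dot, let $I^\bullet(D)=\{1\}$ if there is a dotted inner-most cap at position $1$ and $I^\bullet(D)=\emptyset$ otherwise, and let $I(D)=I^\bullet(D)\cup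 I^\circ(D)$. Let $n\ge1$, and let $D$ be an even $(n+1)$-strand diagram. For $i\in I(D)$ let $D_i$ be the $n$-strand diagram obtained by removing the inner-most cap at position $i$; if $i\le n$, the right-most top point then becomes the right-most bottom point. If $i=1\in I^\bullet(D)$, a dot is moreover added to the strand of $D_1$ through the left-most bottom point, where two dots on the same strand cancel. Put $$\mathrm{coef}(g_{n,1})=\frac{[n]}{[2n]},\qquad \mathrm{coef}(g_{n,i})=\frac{[n]\,[2i-2]}{[2n]\,[i-1]}\quad(2\le i\le n+1).$$ Then every $D_i$, $i\in I(D)$, is an even diagram, and $$\mathrm{coef}_n(D)=\sum_{i\in I(D)}\mathrm{coef}(g_{n,i})\,\mathrm{coef}_{n-1}(D_i).$$ -/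

import Mathlib

/-!
# The Temperley–Lieb algebra of type `D`, its Jones–Wenzl projections, and dotted diagrams
-/

noncomputable section

namespace TypeD

/-- The ground field `ℂ(q)`. -/
abbrev K : Type := RatFunc ℂ

/-- The indeterminate `q`. -/
def q : K := RatFunc.X

/-- The `q`-integer `[n] = (q ^ n - q ^ (-n)) / (q - q ^ (-1))`. -/
def qInt (n : ℕ) : K := (q ^ n - (q ^ n)⁻¹) / (q - q⁻¹)

/-! ### The algebra -/

/-- Adjacency in the Dynkin diagram `D_{n+1}` with nodes `0, 1, …, n`: the edges are `0 — 2` and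
`k — k+1` for `k ≥ 1`. -/
def Adj (i j : ℕ) : Prop :=
  (i = 0 ∧ j = 2) ∨ (i = 2 ∧ j = 0) ∨ (1 ≤ i ∧ j = i + 1) ∨ (1 ≤ j ∧ i = j + 1)

/-- The defining relations of the Temperley–Lieb algebra of type `D_{n+1}`. -/
inductive Rel (n : ℕ) : FreeAlgebra K (Fin (n + 1)) → FreeAlgebra K (Fin (n + 1)) → Prop
  | sq (i : Fin (n + 1)) :
      Rel n (FreeAlgebra.ι K i * FreeAlgebra.ι K i) ((-qInt 2) • FreeAlgebra.ι K i)
  | braid (i j : Fin (n + 1)) (h : Adj i j) :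
      Rel n (FreeAlgebra.ι K i * FreeAlgebra.ι K j * FreeAlgebra.ι K i) (FreeAlgebra.ι K i)
  | comm (i j : Fin (n + 1)) (h : ¬ Adj i j) :
      Rel n (FreeAlgebra.ι K i * FreeAlgebra.ι K j) (FreeAlgebra.ι K j * FreeAlgebra.ι K i)

/-- The Temperley–Lieb algebra of type `D_{n+1}`, with generators `E_0, …, E_n`. -/
def TL (n : ℕ) : Type := RingQuot (Rel n)

instance (n : ℕ) : Ring (TL n) := inferInstanceAs (Ring (RingQuot (Rel n)))

instance (n : ℕ) : Algebra K (TL n) := inferInstanceAs (Algebra K (RingQuot (Rel n)))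

/-- The quotient map from the free algebra. -/
def quot (n : ℕ) : FreeAlgebra K (Fin (n + 1)) →ₐ[K] TL n := RingQuot.mkAlgHom K (Rel n)

theorem quot_rel {n : ℕ} {x y : FreeAlgebra K (Fin (n + 1))} (h : Rel n x y) : quot n x = quot n y :=
  RingQuot.mkAlgHom_rel K h

/-- The generator `E_i`. -/
def E {n : ℕ} (i : Fin (n + 1)) : TL n :=
  quot n (FreeAlgebra.ι K i)

theorem E_sq {n : ℕ} (i : Fin (n + 1)) : E i * E i = (-qInt 2) • E i := by
  have h := quot_rel (Rel.sq i)
  rwa [map_mul, map_smul] at h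

theorem E_braid {n : ℕ} {i j : Fin (n + 1)} (hij : Adj i j) : E i * E j * E i = E i := by
  have h := quot_rel (Rel.braid i j hij)
  rwa [map_mul, map_mul] at h

theorem E_comm {n : ℕ} {i j : Fin (n + 1)} (hij : ¬ Adj i j) : E i * E j = E j * E i := by
  have h := quot_rel (Rel.comm i j hij)
  rwa [map_mul, map_mul] at h

/-- The canonical homomorphism from the algebra of type `D_{m+1}` to that of type `D_{n+1}`,
`m ≤ n`, with `E_i ↦ E_i`. -/
def incl {m n : ℕ} (h : m ≤ n) : TL m →ₐ[K] TL n :=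
  RingQuot.liftAlgHom K
    ⟨FreeAlgebra.lift K fun i : Fin (m + 1) => E (Fin.castLE (Nat.succ_le_succ h) i), by
      rintro _ _ (i | ⟨i, j, hij⟩ | ⟨i, j, hij⟩)
      · simpa [neg_smul] using E_sq (n := n) (Fin.castLE (Nat.succ_le_succ h) i)
      · simpa using E_braid (n := n) (i := Fin.castLE (Nat.succ_le_succ h) i)
          (j := Fin.castLE (Nat.succ_le_succ h) j) hij
      · simpa using E_comm (n := n) (i := Fin.castLE (Nat.succ_le_succ h) i)
          (j := Fin.castLE (Nat.succ_le_succ h) j) hij⟩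

/-- The element `E_w = E_{s_1} ⋯ E_{s_l}` of a word `w = (s_1, …, s_l)`. -/
def word {n : ℕ} (w : List (Fin (n + 1))) : TL n := (w.map E).prod

/-- `w` is a reduced expression: `E_w` cannot be written (up to a scalar) with fewer generators. -/
def IsReduced {n : ℕ} (w : List (Fin (n + 1))) : Prop :=
  ∀ (v : List (Fin (n + 1))) (r : K), word w = r • word v → w.length ≤ v.length

/-- The family `Q_0, Q_1, …` of Jones–Wenzl projections, `Q_n` in type `D_{n+1}`. -/
structure IsJonesWenzl (Q : ∀ n, TL n) : Prop where
  ne_zero : ∀ n, Q n ≠ 0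
  mul_incl : ∀ (i n : ℕ) (h : i ≤ n), Q n * incl h (Q i) = Q n
  incl_mul : ∀ (i n : ℕ) (h : i ≤ n), incl h (Q i) * Q n = Q n
  E_mul : ∀ (n : ℕ) (i : Fin (n + 1)), E i * Q n = 0
  mul_E : ∀ (n : ℕ) (i : Fin (n + 1)), Q n * E i = 0

/-! ### Dotted diagrams -/

/-- The data of a dotted pairing of the `2n+2` marked points of an `(n+1)`-strand diagram.
The points are numbered around the boundary, starting at the bottom left: for `1 ≤ k ≤ n+1` the
`k`-th bottom point has number `k - 1`, and the `k`-th top point has number `2n+2-k`.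
`mate a` is the point joined to `a`, and `dot a` says whether the strand through `a` is dotted. -/
@[ext] structure Diagram (n : ℕ) where
  mate : Fin (2 * n + 2) → Fin (2 * n + 2)
  dot : Fin (2 * n + 2) → Bool

namespace Diagram

variable {n : ℕ}

/-- No other strand separates the strand through `a` from the left side of the diagram. For a
cap or a cup: there is no larger one around it and no vertical strand to its left.
For a vertical strand: it is the left-most one. -/
def IsOuter (D : Diagram n) (a : Fin (2 * n + 2)) : Prop :=
  ∀ c, ¬ (c < a ∧ c < D.mate a ∧ a < D.mate c ∧ D.mate a < D.mate c)

/-- The number of dots; each strand is counted at its endpoint of smaller number. -/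
def numDots (D : Diagram n) : ℕ :=
  (Finset.univ.filter fun a => D.dot a = true ∧ a < D.mate a).card

/-- `D` is an `(n+1)`-strand Temperley–Lieb diagram (a non-crossing perfect pairing) with an even
number of dots, at most one on each strand, all of them on outer-most caps, outer-most cups or the
left-most vertical strand. -/
structure IsEven (D : Diagram n) : Prop where
  mate_mate : ∀ a, D.mate (D.mate a) = a
  mate_ne : ∀ a, D.mate a ≠ a
  noncrossing : ∀ a b, a < b → b < D.mate a → D.mate b < D.mate a
  dot_mate : ∀ a, D.dot (D.mate a) = D.dot a
  dot_outer : ∀ a, D.dot a = true → D.IsOuter a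
  even_dots : Even D.numDots

/-- The diagram of the identity: `n+1` vertical strands and no dots. -/
def one (n : ℕ) : Diagram n where
  mate := Fin.rev
  dot := fun _ => false

/-- `D` has an inner-most cap at position `i`, for `1 ≤ i ≤ n+1`: the points numbered `i - 1` and
`i` are joined. For `i ≤ n` these are the `i`-th and `(i+1)`-th bottom points; for `i = n+1` they
are the right-most bottom point and the right-most top point. -/
def HasCap (D : Diagram n) (i : ℕ) : Prop :=
  ∃ a b : Fin (2 * n + 2), (a : ℕ) + 1 = i ∧ (b : ℕ) = i ∧ D.mate a = b

/-- The strand through the point numbered `i - 1` has a dot. For a diagram with an inner-most cap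
at position `i`, this says that this cap is dotted. -/
def DottedAt (D : Diagram n) (i : ℕ) : Prop :=
  ∃ a : Fin (2 * n + 2), (a : ℕ) + 1 = i ∧ D.dot a = true

/-- For `E_i` with `i ≥ 1` the cup and the cap of its diagram are at position `i`; for `E_0` they
are at position `1`. -/
def pos (i : Fin (n + 1)) : ℕ := max i 1

/-- The point numbered `pos i - 1`, which is the left end of the cap of `E_i`. -/
def left (i : Fin (n + 1)) : Fin (2 * n + 2) := ⟨pos i - 1, by have := i.2; unfold pos; omega⟩

/-- The point numbered `pos i`, which is the right end of the cap of `E_i`. -/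
def right (i : Fin (n + 1)) : Fin (2 * n + 2) := ⟨pos i, by have := i.2; unfold pos; omega⟩

/-- The diagram obtained by putting `D` on the top of the diagram of `E_i`, provided that `D` has
no cap at position `pos i`, so that no closed loop arises. The two strands of `D` ending where the
cup of `E_i` is are merged, and the cap of `E_i` is new. The cup and the cap of `E_0` are
dotted, and two dots on the same strand cancel. -/
def attach (D : Diagram n) (i : Fin (n + 1)) : Diagram n where
  mate := fun k =>
    if k = left i then right i
    else if k = right i then left i
    else if k = D.mate (left i) then D.mate (right i)
    else if k = D.mate (right i) then D.mate (left i)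
    else D.mate k
  dot := fun k =>
    if k = left i ∨ k = right i then decide (i = 0)
    else if k = D.mate (left i) ∨ k = D.mate (right i) then
      xor (xor (D.dot (left i)) (D.dot (right i))) (decide (i = 0))
    else D.dot k

/-- `Draws w D`: stacking the diagrams of the generators in the word `w`, from top to bottom,
gives `D`, and no closed loop arises. (A reduced expression in which a closed loop arises
contains the product `E_0 E_1`; the loop has one dot, and its diagram has an odd number of dots.) -/
inductive Draws : List (Fin (n + 1)) → Diagram n → Prop
  | nil : Draws [] (one n)
  | snoc (w : List (Fin (n + 1))) (D : Diagram n) (i : Fin (n + 1)) (h : Draws w D)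
      (hi : ¬ D.HasCap (pos i)) : Draws (w ++ [i]) (D.attach i)

/-- The inclusion of the remaining `2n+2` points into the `2n+4` points of an `(n+2)`-strand
diagram, when the points numbered `i - 1` and `i` are deleted. -/
def skip (i : ℕ) (k : Fin (2 * n + 2)) : Fin (2 * (n + 1) + 2) :=
  ⟨if (k : ℕ) + 1 < i then k else k + 2, by have := k.2; split_ifs <;> omega⟩

/-- The renumbering of the remaining points, when the points numbered `i - 1` and `i` are
deleted; for `1 ≤ i ≤ n+2` it inverts `skip i`. -/
def unskip (i : ℕ) (k : Fin (2 * (n + 1) + 2)) : Fin (2 * n + 2) :=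
  Fin.ofNat (2 * n + 2) (if (k : ℕ) + 1 < i then k else k - 2)

/-- The diagram `D` with its inner-most cap at position `i` removed. The remaining points
are read in the same order around the boundary, so that the right-most top point of `D` becomes
the right-most bottom point (or, for `i = n+2`, the right-most vertical strand is
just deleted). -/
def erase (D : Diagram (n + 1)) (i : ℕ) : Diagram n where
  mate := fun k => unskip i (D.mate (skip i k))
  dot := fun k => D.dot (skip i k)

/-- Add a dot on the strand through the left-most bottom point; two dots on it cancel. -/
def toggle (D : Diagram n) : Diagram n where
  mate := D.mate
  dot := fun k => if k = 0 ∨ k = D.mate 0 then !(D.dot k) else D.dot k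

open Classical in
/-- `I^•(D)`: it is `{1}` if there is a dotted inner-most cap at position `1`, else empty. -/
def dottedPositions (D : Diagram n) : Finset ℕ :=
  if D.HasCap 1 ∧ D.DottedAt 1 then {1} else ∅

open Classical in
/-- `I^∘(D)`: the positions of the inner-most caps without a dot. -/
def undottedPositions (D : Diagram n) : Finset ℕ :=
  (Finset.Icc 1 (n + 1)).filter fun i => D.HasCap i ∧ ¬ D.DottedAt i

/-- `I(D) = I^•(D) ∪ I^∘(D)`. -/
def positions (D : Diagram n) : Finset ℕ := D.dottedPositions ∪ D.undottedPositions

open Classical in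
/-- The diagram `D_i`. -/
def reduce (D : Diagram (n + 1)) (i : ℕ) : Diagram n :=
  if i = 1 ∧ i ∈ D.dottedPositions then (D.erase i).toggle else D.erase i

end Diagram

/-! ### Coefficients -/

/-- `r` is the coefficient of the diagram `D` in `x`: there is an expansion of `x` as a linear
combination of the elements `E_w`, `w` a reduced expression, in which `r` is the coefficient of
an element whose diagram is `D`. -/
def IsCoef {n : ℕ} (x : TL n) (D : Diagram n) (r : K) : Prop :=
  ∃ a : TL n →₀ K,
    (∀ y ∈ a.support, ∃ w : List (Fin (n + 1)), IsReduced w ∧ word w = y) ∧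
    (a.sum fun y s => s • y) = x ∧
    ∃ w : List (Fin (n + 1)), IsReduced w ∧ Diagram.Draws w D ∧ a (word w) = r

/-- The coefficient `coef(g_{n,i})`. -/
def coefG (n i : ℕ) : K :=
  if i = 1 then qInt n / qInt (2 * n)
  else qInt n * qInt (2 * i - 2) / (qInt (2 * n) * qInt (i - 1))

end TypeD

end

noncomputable section

namespace TypeD

namespace Diagram

variable {n : ℕ}

/-! ### Deleting and inserting two neighbouring points -/

/-! The coefficient of an even diagram turns out to be a linear functional on the algebra. Let the
algebra act from the right on the span of the even diagrams by stacking, where a loop without dots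
counts as `-[2]` and a loop with one dot as `0`. Applying `x` to the identity diagram gives `diag
x`. A reduced word either runs into a dotted loop, and then `diag` kills it, or it draws an even
diagram `D`, and then its element is a normal form `nf n D` which depends only on `D` and satisfies
`diag (nf n D) = D`. So in every expansion of `x` in reduced words the coefficient at `nf n D` is
the `D`-entry of `diag x` (`isCoef_iff`); linear independence of all reduced words is not needed.

Diagrams are handled by induction on inner-most caps. Every even diagram with at least two strands
arises by inserting a cap at a slot `s`, and `E_k` acts on such a diagram by four rules: a factor
`-[2]` if `k = s`; zero if `{s, k} = {0, 1}`; the cap moves to slot `k` if `s` and `k` are adjacent;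
otherwise `E_k` acts on the smaller diagram as `E_{shift s k}`. The defining relations follow from
these rules. All but the second also hold in the algebra for the products `desc (n + 1) s`, which
makes the normal form well defined (`nf_insE`) and compatible with the action (`nf_mul_gen`).

The projections satisfy `Q_{n+1} = Q_n * stepFactor n`, where the step factor combines the products
`desc` with the coefficients of the theorem and correction terms `tail`. Three-term recurrences for
the coefficients show that all generators annihilate this from the right; augmentation and the
anti-automorphism fixing the generators give left annihilation and uniqueness. Each `tail` contains
`E_0 E_1` and vanishes under `diag`, so `diag Q_{n+1}` is the sum of the insertions of caps into
`diag Q_n`. Its `D`-entry has one summand for each slot at which `D` has an inner-most cap. -/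

theorem val_skip (i : ℕ) (k : Fin (2 * n + 2)) :
    (skip i k : ℕ) = if (k : ℕ) + 1 < i then (k : ℕ) else k + 2 := rfl

theorem skip_strictMono (i : ℕ) : StrictMono (skip (n := n) i) := by
  intro a b h
  rw [Fin.lt_def] at h ⊢
  rw [val_skip, val_skip]
  split_ifs <;> omega

theorem skip_inj {i : ℕ} {a b : Fin (2 * n + 2)} : skip i a = skip i b ↔ a = b :=
  (skip_strictMono i).injective.eq_iff

theorem skip_lt {i : ℕ} {a b : Fin (2 * n + 2)} : skip i a < skip i b ↔ a < b :=
  (skip_strictMono i).lt_iff_lt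

theorem unskip_skip {i : ℕ} (k : Fin (2 * n + 2)) : unskip i (skip i k) = k := by
  have := k.2
  ext
  simp only [unskip, val_skip, Fin.ofNat]
  split_ifs <;> first | omega | (rw [Nat.mod_eq_of_lt] <;> omega)

/-- The left point of a cap at position `i`. -/
def lo (n i : ℕ) : Fin (2 * n + 2) := Fin.ofNat _ (i - 1)

/-- The right point of a cap at position `i`. -/
def hi (n i : ℕ) : Fin (2 * n + 2) := Fin.ofNat _ i

theorem val_lo {i : ℕ} (h : i ≤ n + 1) : (lo n i : ℕ) = i - 1 := by
  simp only [lo, Fin.ofNat]; rw [Nat.mod_eq_of_lt]; omega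

theorem val_hi {i : ℕ} (h : i ≤ n + 1) : (hi n i : ℕ) = i := by
  simp only [hi, Fin.ofNat]; rw [Nat.mod_eq_of_lt]; omega

theorem lo_ne_hi {i : ℕ} (h1 : 1 ≤ i) (h : i ≤ n + 1) : lo n i ≠ hi n i := by
  rw [Ne, Fin.ext_iff, val_lo h, val_hi h]; omega

theorem skip_ne_lo {i : ℕ} (h1 : 1 ≤ i) (h : i ≤ n + 2) (y : Fin (2 * n + 2)) :
    skip i y ≠ lo (n + 1) i := by
  rw [Ne, Fin.ext_iff, val_lo h, val_skip]; split_ifs <;> omega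

theorem skip_ne_hi {i : ℕ} (h1 : 1 ≤ i) (h : i ≤ n + 2) (y : Fin (2 * n + 2)) :
    skip i y ≠ hi (n + 1) i := by
  rw [Ne, Fin.ext_iff, val_hi h, val_skip]; split_ifs <;> omega

theorem lo_or_hi_or_skip {i : ℕ} (h1 : 1 ≤ i) (h : i ≤ n + 2) (x : Fin (2 * (n + 1) + 2)) :
    x = lo (n + 1) i ∨ x = hi (n + 1) i ∨ ∃ y, x = skip i y := by
  have hx := x.2
  rcases lt_trichotomy ((x : ℕ) + 1) i with h2 | h2 | h2
  · refine Or.inr (Or.inr ⟨⟨x, by omega⟩, ?_⟩)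
    rw [Fin.ext_iff, val_skip]; simp [h2]
  · left; rw [Fin.ext_iff, val_lo h]; omega
  · rcases eq_or_ne (x : ℕ) i with h3 | h3
    · right; left; rw [Fin.ext_iff, val_hi h]; omega
    · refine Or.inr (Or.inr ⟨⟨x - 2, by omega⟩, ?_⟩)
      rw [Fin.ext_iff, val_skip]; simp only; split_ifs <;> omega

theorem hasCap_iff {D : Diagram n} {i : ℕ} (h1 : 1 ≤ i) (h : i ≤ n + 1) :
    D.HasCap i ↔ D.mate (lo n i) = hi n i := by
  constructor
  · rintro ⟨a, b, ha, hb, hab⟩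
    have : lo n i = a := by rw [Fin.ext_iff, val_lo h]; omega
    rw [this, hab, Fin.ext_iff, val_hi h]; omega
  · intro hm
    exact ⟨lo n i, hi n i, by rw [val_lo h]; omega, val_hi h, hm⟩

theorem dottedAt_iff {D : Diagram n} {i : ℕ} (h1 : 1 ≤ i) (h : i ≤ n + 1) :
    D.DottedAt i ↔ D.dot (lo n i) = true := by
  constructor
  · rintro ⟨a, ha, hd⟩
    have : lo n i = a := by rw [Fin.ext_iff, val_lo h]; omega
    rwa [this]
  · intro hm
    exact ⟨lo n i, by rw [val_lo h]; omega, hm⟩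

/-- Dotted non-crossing pairings with dots on outer strands, without a parity condition. -/
structure IsDotted (D : Diagram n) : Prop where
  mate_mate : ∀ a, D.mate (D.mate a) = a
  mate_ne : ∀ a, D.mate a ≠ a
  noncrossing : ∀ a b, a < b → b < D.mate a → D.mate b < D.mate a
  dot_mate : ∀ a, D.dot (D.mate a) = D.dot a
  dot_outer : ∀ a, D.dot a = true → D.IsOuter a

theorem isEven_iff {D : Diagram n} : D.IsEven ↔ D.IsDotted ∧ Even D.numDots :=
  ⟨fun h => ⟨⟨h.1, h.2, h.3, h.4, h.5⟩, h.6⟩, fun ⟨h, h'⟩ => ⟨h.1, h.2, h.3, h.4, h.5, h'⟩⟩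

theorem IsEven.isDotted {D : Diagram n} (h : D.IsEven) : D.IsDotted := (isEven_iff.1 h).1

/-- Insert a cap at position `i`, with a dot if `b` holds. -/
def insCap (i : ℕ) (b : Bool) (D : Diagram n) : Diagram (n + 1) where
  mate x := if x = lo (n + 1) i then hi (n + 1) i else if x = hi (n + 1) i then lo (n + 1) i
    else skip i (D.mate (unskip i x))
  dot x := if x = lo (n + 1) i ∨ x = hi (n + 1) i then b else D.dot (unskip i x)

/-! ### Inserting and erasing a cap are mutually inverse -/

section insCap

variable {i : ℕ} {b : Bool} {D : Diagram n}

theorem insCap_mate_lo : (insCap i b D).mate (lo (n + 1) i) = hi (n + 1) i := by simp [insCap]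

theorem insCap_mate_hi (h1 : 1 ≤ i) (h : i ≤ n + 2) :
    (insCap i b D).mate (hi (n + 1) i) = lo (n + 1) i := by
  simp [insCap, (lo_ne_hi h1 h).symm]

theorem insCap_mate_skip (h1 : 1 ≤ i) (h : i ≤ n + 2) (y : Fin (2 * n + 2)) :
    (insCap i b D).mate (skip i y) = skip i (D.mate y) := by
  simp [insCap, skip_ne_lo h1 h, skip_ne_hi h1 h, unskip_skip]

theorem insCap_dot_lo : (insCap i b D).dot (lo (n + 1) i) = b := by simp [insCap]

theorem insCap_dot_hi : (insCap i b D).dot (hi (n + 1) i) = b := by simp [insCap]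

theorem insCap_dot_skip (h1 : 1 ≤ i) (h : i ≤ n + 2) (y : Fin (2 * n + 2)) :
    (insCap i b D).dot (skip i y) = D.dot y := by
  simp [insCap, skip_ne_lo h1 h, skip_ne_hi h1 h, unskip_skip]

theorem erase_insCap (h1 : 1 ≤ i) (h : i ≤ n + 2) : (insCap i b D).erase i = D := by
  ext y
  · simp [erase, insCap_mate_skip h1 h, unskip_skip]
  · simp [erase, insCap_dot_skip h1 h]

theorem ext_skip {D D' : Diagram (n + 1)} (h1 : 1 ≤ i) (h : i ≤ n + 2)
    (hl : D.mate (lo (n + 1) i) = D'.mate (lo (n + 1) i) ∧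
      D.dot (lo (n + 1) i) = D'.dot (lo (n + 1) i))
    (hh : D.mate (hi (n + 1) i) = D'.mate (hi (n + 1) i) ∧
      D.dot (hi (n + 1) i) = D'.dot (hi (n + 1) i))
    (hs : ∀ y : Fin (2 * n + 2), D.mate (skip i y) = D'.mate (skip i y) ∧
      D.dot (skip i y) = D'.dot (skip i y)) : D = D' := by
  have key : ∀ x, D.mate x = D'.mate x ∧ D.dot x = D'.dot x := by
    intro x
    rcases lo_or_hi_or_skip h1 h x with rfl | rfl | ⟨y, rfl⟩
    exacts [hl, hh, hs y]
  exact Diagram.ext (funext fun x => (key x).1) (funext fun x => (key x).2)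

theorem eq_insCap {D : Diagram (n + 1)} {E : Diagram n} (h1 : 1 ≤ i) (h : i ≤ n + 2)
    (hl : D.mate (lo (n + 1) i) = hi (n + 1) i ∧ D.dot (lo (n + 1) i) = b)
    (hh : D.mate (hi (n + 1) i) = lo (n + 1) i ∧ D.dot (hi (n + 1) i) = b)
    (hs : ∀ y : Fin (2 * n + 2), D.mate (skip i y) = skip i (E.mate y) ∧
      D.dot (skip i y) = E.dot y) : D = insCap i b E := by
  refine ext_skip h1 h ?_ ?_ fun y => ?_
  · rwa [insCap_mate_lo, insCap_dot_lo]
  · rwa [insCap_mate_hi h1 h, insCap_dot_hi]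
  · rw [insCap_mate_skip h1 h, insCap_dot_skip h1 h]; exact hs y

theorem skip_unskip (h1 : 1 ≤ i) (h : i ≤ n + 2) {x : Fin (2 * (n + 1) + 2)}
    (hl : x ≠ lo (n + 1) i) (hh : x ≠ hi (n + 1) i) : skip i (unskip (n := n) i x) = x := by
  rcases lo_or_hi_or_skip h1 h x with h | h | ⟨y, rfl⟩
  · exact absurd h hl
  · exact absurd h hh
  · rw [unskip_skip]

/-- `unskip` inverts `skip` only off the two deleted points. These are joined to each other, so no
remaining point is joined to one of them. -/
theorem skip_erase_mate {D : Diagram (n + 1)} (hD : ∀ a, D.mate (D.mate a) = a) (h1 : 1 ≤ i)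
    (h : i ≤ n + 2) (hc : D.mate (lo (n + 1) i) = hi (n + 1) i) (y : Fin (2 * n + 2)) :
    skip i ((D.erase i).mate y) = D.mate (skip i y) := by
  refine skip_unskip h1 h (fun h2 => ?_) fun h2 => ?_
  · have := hD (skip i y)
    rw [h2, hc] at this
    exact skip_ne_hi h1 h y this.symm
  · rw [← hc] at h2
    have := congrArg D.mate h2
    rw [hD, hD] at this
    exact skip_ne_lo h1 h y this

theorem insCap_erase {D : Diagram (n + 1)} (hD : D.IsDotted) (h1 : 1 ≤ i)
    (h : i ≤ n + 2) (hc : D.mate (lo (n + 1) i) = hi (n + 1) i) (hb : D.dot (lo (n + 1) i) = b) :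
    insCap i b (D.erase i) = D := by
  refine (eq_insCap h1 h ⟨hc, hb⟩ ⟨?_, ?_⟩ fun y => ⟨?_, rfl⟩).symm
  · rw [← hc, hD.mate_mate]
  · rw [← hc, hD.dot_mate, hb]
  · rw [skip_erase_mate hD.mate_mate h1 h hc]

theorem IsDotted.erase {D : Diagram (n + 1)} (hD : D.IsDotted) (h1 : 1 ≤ i)
    (h : i ≤ n + 2) (hc : D.mate (lo (n + 1) i) = hi (n + 1) i) : (D.erase i).IsDotted := by
  have hm := skip_erase_mate hD.mate_mate h1 h hc
  refine ⟨fun a => ?_, fun a ha => ?_, fun a b hab hb => ?_, fun a => ?_, fun a ha c hc => ?_⟩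
  · rw [← skip_inj (i := i), hm, hm, hD.mate_mate]
  · rw [← skip_inj (i := i), hm] at ha
    exact hD.mate_ne _ ha
  · rw [← skip_lt (i := i)] at hab hb ⊢
    rw [hm] at hb ⊢
    rw [hm]
    exact hD.noncrossing _ _ hab hb
  · change D.dot (skip i _) = D.dot (skip i a)
    rw [hm, hD.dot_mate]
  · refine hD.dot_outer (skip i a) ha (skip i c) ?_
    simpa only [← hm, skip_lt] using hc

/-- No point lies between the two ends of the new cap, so it neither crosses nor covers anything. A
dotted cap must be at position 1, where its left end is the first point, so nothing can surround it.
-/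
theorem IsDotted.insCap {D : Diagram n} (hD : D.IsDotted) (h1 : 1 ≤ i)
    (h : i ≤ n + 2) (hb : b = true → i = 1) : (insCap i b D).IsDotted := by
  have key : ∀ x : Fin (2 * (n + 1) + 2), ¬ (lo (n + 1) i < x ∧ x < hi (n + 1) i) := by
    rintro x ⟨hx, hx'⟩
    rw [Fin.lt_def] at hx hx'
    rw [val_lo h] at hx
    rw [val_hi h] at hx'
    omega
  have key1 : lo (n + 1) i < hi (n + 1) i := by
    rw [Fin.lt_def, val_lo h, val_hi h]; omega
  have key2 : ∀ x : Fin (2 * (n + 1) + 2), x < hi (n + 1) i → x ≠ lo (n + 1) i →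
      x < lo (n + 1) i := by
    intro x hx hx'
    exact lt_of_le_of_ne (not_lt.1 fun h => key x ⟨h, hx⟩) hx'
  have key3 : ∀ x : Fin (2 * (n + 1) + 2), lo (n + 1) i < x → x ≠ hi (n + 1) i →
      hi (n + 1) i < x := by
    intro x hx hx'
    exact lt_of_le_of_ne (not_lt.1 fun h => key x ⟨hx, h⟩) hx'.symm
  have hl := insCap_mate_lo (i := i) (b := b) (D := D)
  have hh := insCap_mate_hi (b := b) (D := D) h1 h
  have hs := insCap_mate_skip (b := b) (D := D) h1 h
  refine ⟨fun a => ?_, fun a ha => ?_, fun a c hac hc => ?_, fun a => ?_, fun a ha c hc => ?_⟩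
  · rcases lo_or_hi_or_skip h1 h a with rfl | rfl | ⟨y, rfl⟩
    · rw [hl, hh]
    · rw [hh, hl]
    · rw [hs, hs, hD.mate_mate]
  · rcases lo_or_hi_or_skip h1 h a with rfl | rfl | ⟨y, rfl⟩
    · rw [hl] at ha; exact lo_ne_hi h1 h ha.symm
    · rw [hh] at ha; exact lo_ne_hi h1 h ha
    · rw [hs, skip_inj] at ha; exact hD.mate_ne _ ha
  · rcases lo_or_hi_or_skip h1 h a with rfl | rfl | ⟨y, rfl⟩
    · rw [hl] at hc; exact absurd ⟨hac, hc⟩ (key c)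
    · rw [hh] at hc; exact absurd (hac.trans hc) (not_lt.2 key1.le)
    · rw [hs] at hc ⊢
      rcases lo_or_hi_or_skip h1 h c with rfl | rfl | ⟨z, rfl⟩
      · rw [hl]; exact key3 _ hc (skip_ne_hi h1 h _)
      · rw [hh]; exact key1.trans hc
      · rw [hs]
        rw [skip_lt] at hac hc ⊢
        exact hD.noncrossing _ _ hac hc
  · rcases lo_or_hi_or_skip h1 h a with rfl | rfl | ⟨y, rfl⟩
    · rw [hl, insCap_dot_hi, insCap_dot_lo]
    · rw [hh, insCap_dot_hi, insCap_dot_lo]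
    · rw [hs, insCap_dot_skip h1 h, insCap_dot_skip h1 h, hD.dot_mate]
  · rcases lo_or_hi_or_skip h1 h a with rfl | rfl | ⟨y, rfl⟩
    · rw [insCap_dot_lo] at ha
      have := Fin.lt_def.1 hc.1
      rw [val_lo h, hb ha] at this
      omega
    · rw [insCap_dot_hi] at ha
      have := Fin.lt_def.1 hc.2.1
      rw [hh, val_lo h, hb ha] at this
      omega
    · rw [insCap_dot_skip h1 h] at ha
      rw [hs] at hc
      rcases lo_or_hi_or_skip h1 h c with rfl | rfl | ⟨z, rfl⟩
      · rw [hl] at hc; exact key _ ⟨hc.1, hc.2.2.1⟩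
      · rw [hh] at hc; exact lt_asymm key1 (hc.1.trans hc.2.2.1)
      · rw [hs] at hc
        simp only [skip_lt] at hc
        exact hD.dot_outer y ha z hc

end insCap

/-! ### Toggling a dot and counting dots -/

theorem toggle_toggle {D : Diagram n} : D.toggle.toggle = D := by
  ext x
  · rfl
  · simp only [toggle]; split_ifs <;> simp

theorem IsDotted.toggle {D : Diagram n} (hD : D.IsDotted) : D.toggle.IsDotted := by
  refine ⟨hD.1, hD.2, hD.3, fun a => ?_, fun a ha c hc => ?_⟩
  · have h1 := hD.mate_mate a
    have h2 := hD.mate_mate 0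
    have h3 := hD.dot_mate a
    have h4 : (D.mate a = 0 ∨ D.mate a = D.mate 0) ↔ (a = 0 ∨ a = D.mate 0) := by grind
    simp only [Diagram.toggle, h4, h3]
  · simp only [Diagram.toggle] at ha hc
    split_ifs at ha with h
    · rcases h with rfl | rfl
      · exact absurd hc.1 (Fin.not_lt_zero c)
      · rw [hD.mate_mate] at hc
        exact absurd hc.2.1 (Fin.not_lt_zero c)
    · exact hD.dot_outer a ha c hc

theorem numDots_eq_sum (D : Diagram n) :
    D.numDots = ∑ a, if D.dot a = true ∧ a < D.mate a then 1 else 0 := by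
  rw [numDots, Finset.card_filter]

/-- The strand through the point `0` is counted at `0`, so toggling changes exactly that summand. -/
theorem even_numDots_toggle {D : Diagram n} (hD : D.IsDotted) :
    Even D.toggle.numDots ↔ ¬ Even D.numDots := by
  have h0 : (0 : Fin (2 * n + 2)) < D.mate 0 := Fin.pos_of_ne_zero (hD.mate_ne 0)
  rw [numDots_eq_sum, numDots_eq_sum, ← Finset.add_sum_erase _ _ (Finset.mem_univ 0),
    ← Finset.add_sum_erase _ _ (Finset.mem_univ (0 : Fin (2 * n + 2)))]
  have : ∀ a ∈ Finset.univ.erase (0 : Fin (2 * n + 2)),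
      (if D.toggle.dot a = true ∧ a < D.toggle.mate a then 1 else 0) =
        if D.dot a = true ∧ a < D.mate a then 1 else 0 := by
    intro a ha
    have ha0 := Finset.ne_of_mem_erase ha
    by_cases h : a = D.mate 0
    · have : ¬ a < D.mate a := by rw [h, hD.mate_mate]; exact Fin.not_lt_zero _
      simp [toggle, this]
    · simp [toggle, h, ha0]
  rw [Finset.sum_congr rfl this]
  simp only [toggle, h0]
  rcases D.dot 0 <;> simp [Nat.even_add_one, Nat.add_comm 1]

theorem sum_skip {M : Type*} [AddCommMonoid M] {i : ℕ} (h1 : 1 ≤ i) (h : i ≤ n + 2)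
    (f : Fin (2 * (n + 1) + 2) → M) :
    ∑ x, f x = f (lo (n + 1) i) + f (hi (n + 1) i) + ∑ y, f (skip i y) := by
  have hu : (Finset.univ : Finset (Fin (2 * (n + 1) + 2))) =
      insert (lo (n + 1) i) (insert (hi (n + 1) i) (Finset.univ.image (skip (n := n) i))) := by
    ext x
    rcases lo_or_hi_or_skip h1 h x with rfl | rfl | ⟨y, rfl⟩ <;> simp
  rw [hu, Finset.sum_insert, Finset.sum_insert, Finset.sum_image, add_assoc]
  · exact fun a _ b _ => skip_inj.1
  · simpa using skip_ne_hi h1 h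
  · simpa using ⟨lo_ne_hi h1 h, skip_ne_lo h1 h⟩

theorem numDots_insCap {D : Diagram n} {i : ℕ} {b : Bool} (h1 : 1 ≤ i) (h : i ≤ n + 2) :
    (insCap i b D).numDots = D.numDots + if b then 1 else 0 := by
  have h2 : lo (n + 1) i < hi (n + 1) i := by
    rw [Fin.lt_def, val_lo h, val_hi h]; omega
  rw [numDots_eq_sum, numDots_eq_sum, sum_skip h1 h]
  simp [insCap_mate_lo, insCap_dot_lo, insCap_dot_hi, insCap_mate_hi h1 h, insCap_mate_skip h1 h,
    insCap_dot_skip h1 h, skip_lt, h2, h2.not_gt, add_comm]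

/-! ### Slots

A slot is a natural number `s`. The slot `0` stands for a dotted cap at position `1`, a slot
`s ≥ 1` for an undotted cap at position `s`. -/

/-- The position of a slot. -/
def spos (s : ℕ) : ℕ := max s 1

theorem one_le_spos (s : ℕ) : 1 ≤ spos s := le_max_right _ _

theorem spos_le {s m : ℕ} (h : s ≤ m + 1) : spos s ≤ m + 1 := by unfold spos; omega

/-- Toggle the dot of the left-most strand if the slot is dotted. -/
def twist (s : ℕ) (D : Diagram n) : Diagram n := if s = 0 then D.toggle else D

/-- Insert a cap at the slot `s`. For `s = 0` the strand through the left-most bottom point of the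
given diagram is toggled. -/
def ins (s : ℕ) (D : Diagram n) : Diagram (n + 1) := insCap (spos s) (decide (s = 0)) (twist s D)

/-- `D` has an inner-most cap at the slot `s`. -/
def HasSlot (D : Diagram n) (s : ℕ) : Prop :=
  D.HasCap (spos s) ∧ (D.DottedAt (spos s) ↔ s = 0)

theorem twist_twist {s : ℕ} {D : Diagram n} : twist s (twist s D) = D := by
  unfold twist; split_ifs <;> simp [toggle_toggle]

theorem twist_mate {s : ℕ} {D : Diagram n} : (twist s D).mate = D.mate := by
  unfold twist; split_ifs <;> rfl

theorem IsDotted.twist {s : ℕ} {D : Diagram n} (h : D.IsDotted) : (twist s D).IsDotted := by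
  unfold Diagram.twist; split_ifs; exacts [h.toggle, h]

/-- The toggle compensates for the dot on an inserted cap. This is why insertion at slot `0`
preserves the parity of the number of dots. -/
theorem even_numDots_twist {s : ℕ} {D : Diagram n} (hD : D.IsDotted) :
    Even ((twist s D).numDots + if s = 0 then 1 else 0) ↔ Even D.numDots := by
  unfold twist
  split_ifs with hs
  · rw [Nat.even_add_one, even_numDots_toggle hD, not_not]
  · rfl

theorem IsEven.ins {s : ℕ} {D : Diagram n} (hs : s ≤ n + 2) (hD : D.IsEven) : (ins s D).IsEven := by
  obtain ⟨h1, h2⟩ := isEven_iff.1 hD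
  refine isEven_iff.2 ⟨h1.twist.insCap (one_le_spos s) (spos_le hs) fun h => ?_, ?_⟩
  · have : s = 0 := by simpa using h
    subst this; rfl
  · rw [Diagram.ins, numDots_insCap (one_le_spos s) (spos_le hs)]
    simpa using (even_numDots_twist h1).2 h2

theorem hasSlot_iff {s : ℕ} {D : Diagram n} (hs : s ≤ n + 1) : D.HasSlot s ↔
    D.mate (lo n (spos s)) = hi n (spos s) ∧ D.dot (lo n (spos s)) = decide (s = 0) := by
  rw [HasSlot, hasCap_iff (one_le_spos s) (spos_le hs), dottedAt_iff (one_le_spos s) (spos_le hs)]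
  by_cases h : s = 0 <;> simp [h]

theorem hasSlot_ins {s : ℕ} {D : Diagram n} (hs : s ≤ n + 2) : (ins s D).HasSlot s := by
  rw [hasSlot_iff hs, ins, insCap_mate_lo, insCap_dot_lo]
  simp

/-- The diagram with the cap at the slot `s` removed. -/
def del (s : ℕ) (D : Diagram (n + 1)) : Diagram n := twist s (D.erase (spos s))

theorem del_ins {s : ℕ} {D : Diagram n} (hs : s ≤ n + 2) : del s (ins s D) = D := by
  rw [del, ins, erase_insCap (one_le_spos s) (spos_le hs), twist_twist]

theorem ins_injective {s : ℕ} (hs : s ≤ n + 2) : Function.Injective (ins (n := n) s) :=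
  Function.LeftInverse.injective fun _ => del_ins hs

theorem ins_del {s : ℕ} {D : Diagram (n + 1)} (hs : s ≤ n + 2) (hD : D.IsDotted)
    (h : D.HasSlot s) : ins s (del s D) = D := by
  obtain ⟨h1, h2⟩ := (hasSlot_iff hs).1 h
  rw [del, ins, twist_twist, insCap_erase hD (one_le_spos s) (spos_le hs) h1 h2]

theorem IsEven.del {s : ℕ} {D : Diagram (n + 1)} (hs : s ≤ n + 2) (hD : D.IsEven)
    (h : D.HasSlot s) : (del s D).IsEven := by
  obtain ⟨h1, h2⟩ := (hasSlot_iff hs).1 h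
  have h3 : (Diagram.del s D).IsDotted := (hD.isDotted.erase (one_le_spos s) (spos_le hs) h1).twist
  refine isEven_iff.2 ⟨h3, ?_⟩
  have h4 := (isEven_iff.1 hD).2
  rw [← ins_del hs hD.isDotted h, Diagram.ins, numDots_insCap (one_le_spos s) (spos_le hs)] at h4
  rw [← even_numDots_twist (s := s) h3]
  simpa using h4

/-- Walking around the boundary from the bottom left, the first point `b` that closes a strand ends
an inner-most cap. It comes no later than half-way, and it carries no dot unless it is at position
1. -/
theorem exists_hasSlot {D : Diagram (n + 1)} (hD : D.IsEven) :
    ∃ s, s ≤ n + 2 ∧ D.HasSlot s := by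
  have hex : ∃ b : ℕ, ∃ h : b < 2 * (n + 1) + 2, D.mate ⟨b, h⟩ < ⟨b, h⟩ := by
    refine ⟨D.mate 0, (D.mate 0).2, ?_⟩
    rw [Fin.eta, hD.mate_mate]
    exact Fin.pos_of_ne_zero (hD.mate_ne 0)
  classical
  obtain ⟨hb, hb'⟩ := Nat.find_spec hex
  have hmin : ∀ a : Fin (2 * (n + 1) + 2), (a : ℕ) < Nat.find hex → a < D.mate a := by
    intro a ha
    refine lt_of_le_of_ne (not_lt.1 fun h => Nat.find_min hex ha ⟨a.2, h⟩) (hD.mate_ne a).symm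
  generalize Nat.find hex = b at *
  set B : Fin (2 * (n + 1) + 2) := ⟨b, hb⟩
  have hB : (B : ℕ) = b := rfl
  -- Otherwise the point after the mate of `b` starts a strand which, by non-crossing, closes before
  -- `b`.
  have hadj : (D.mate B : ℕ) + 1 = b := by
    by_contra hne
    have h1 : (D.mate B : ℕ) < b := hb'
    let c : Fin (2 * (n + 1) + 2) := ⟨D.mate B + 1, by omega⟩
    have hc : (c : ℕ) = D.mate B + 1 := rfl
    have h2 := hmin c (by omega)
    have h3 := hD.noncrossing (D.mate B) c (by rw [Fin.lt_def]; omega)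
      (by rw [hD.mate_mate, Fin.lt_def]; omega)
    rw [hD.mate_mate] at h3
    have h4 := hmin (D.mate c) (by rw [Fin.lt_def] at h3; omega)
    rw [hD.mate_mate] at h4
    exact lt_asymm h2 h4
  -- The `b` points before `b` are all opening, so their mates are `b` distinct points among the
  -- remaining ones; hence `2b ≤ 2n + 4`.
  have hle : b ≤ n + 2 := by
    by_contra hlt
    have hinj : Set.InjOn D.mate (Finset.univ.filter fun a : Fin (2 * (n + 1) + 2) => (a : ℕ) < b) :=
      fun x _ y _ hxy => by rw [← hD.mate_mate x, hxy, hD.mate_mate]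
    have hsub : (Finset.univ.filter fun a : Fin (2 * (n + 1) + 2) => (a : ℕ) < b).image D.mate ⊆
        Finset.univ.filter fun a : Fin (2 * (n + 1) + 2) => ¬ (a : ℕ) < b := by
      intro x hx
      simp only [Finset.mem_image, Finset.mem_filter, Finset.mem_univ, true_and] at hx ⊢
      obtain ⟨a, ha, rfl⟩ := hx
      intro h
      have h1 := hmin a ha
      have h2 := hmin _ h
      rw [hD.mate_mate] at h2
      exact lt_asymm h1 h2
    have h1 := Finset.card_le_card hsub
    rw [Finset.card_image_of_injOn hinj] at h1
    have h2 := Finset.card_filter_add_card_filter_not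
      (s := (Finset.univ : Finset (Fin (2 * (n + 1) + 2)))) (fun a => (a : ℕ) < b)
    have h3 : (Finset.univ.filter fun a : Fin (2 * (n + 1) + 2) => (a : ℕ) < b).card = b := by
      rw [Fin.card_filter_val_lt]; omega
    rw [Finset.card_univ, Fintype.card_fin] at h2
    omega
  have hlo : D.mate B = lo (n + 1) b := by
    rw [Fin.ext_iff, val_lo hle]; omega
  have hhi : B = hi (n + 1) b := by rw [Fin.ext_iff, val_hi hle]
  have hm : D.mate (lo (n + 1) b) = hi (n + 1) b := by rw [← hlo, hD.mate_mate, hhi]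
  rcases Nat.lt_or_ge 1 b with h1 | h1
  · refine ⟨b, hle, (hasSlot_iff hle).2 ?_⟩
    have : spos b = b := by unfold spos; omega
    rw [this]
    refine ⟨hm, ?_⟩
    have h0 : b ≠ 0 := by omega
    rw [decide_eq_false h0, ← Bool.not_eq_true]
    intro hd
    -- The strand through the point `0` closes after `b`, so it separates the cap from the left
    -- side.
    have h5 := hmin 0 (by simpa using by omega)
    refine hD.dot_outer _ hd 0 ⟨?_, ?_, ?_, ?_⟩
    · rw [Fin.lt_def, val_lo hle]; simpa using by omega
    · rw [hm, Fin.lt_def, val_hi hle]; simpa using by omega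
    · have h6 : ¬ (D.mate 0 : ℕ) < b := fun h => by
        have := hmin _ h
        rw [hD.mate_mate] at this
        exact lt_asymm this h5
      rw [Fin.lt_def, val_lo hle]; omega
    · rw [hm]
      have h6 : ¬ (D.mate 0 : ℕ) < b := fun h => by
        have := hmin _ h
        rw [hD.mate_mate] at this
        exact lt_asymm this h5
      refine lt_of_le_of_ne (by rw [Fin.le_def, val_hi hle]; omega) fun h => ?_
      have h7 := congrArg D.mate h
      rw [hD.mate_mate, ← hm, hD.mate_mate, Fin.ext_iff, val_lo hle] at h7
      simp at h7
      omega
  · have hb1 : b = 1 := by omega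
    subst hb1
    rcases hd : D.dot (lo (n + 1) 1) with _ | _
    · exact ⟨1, by omega, (hasSlot_iff (by omega)).2 ⟨hm, hd⟩⟩
    · exact ⟨0, by omega, (hasSlot_iff (by omega)).2 ⟨hm, hd⟩⟩

theorem exists_eq_ins {D : Diagram (n + 1)} (hD : D.IsEven) :
    ∃ s ≤ n + 2, ∃ D' : Diagram n, D'.IsEven ∧ D = ins s D' := by
  obtain ⟨s, hs, h⟩ := exists_hasSlot hD
  exact ⟨s, hs, del s D, hD.del hs h, (ins_del hs hD.isDotted h).symm⟩

/-! ### Attaching a generator and inserting a cap -/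

/-- Merge the strands through the points `a` and `b`, and join `a` and `b` by a new cap. The new
strands both get an additional dot if `c` holds. -/
def join (D : Diagram n) (a b : Fin (2 * n + 2)) (c : Bool) : Diagram n where
  mate k := if k = a then b else if k = b then a else if k = D.mate a then D.mate b
    else if k = D.mate b then D.mate a else D.mate k
  dot k := if k = a ∨ k = b then c else if k = D.mate a ∨ k = D.mate b then
    xor (xor (D.dot a) (D.dot b)) c else D.dot k

theorem attach_eq_join (D : Diagram n) (i : Fin (n + 1)) :
    D.attach i = D.join (left i) (right i) (decide (i = 0)) := rfl

theorem join_comm {D : Diagram n} (hD : D.IsDotted) {a b : Fin (2 * n + 2)} (hab : a ≠ b)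
    (c : Bool) : D.join a b c = D.join b a c := by
  have h : D.mate a ≠ D.mate b := fun h => hab (by rw [← hD.mate_mate a, h, hD.mate_mate])
  ext k
  · simp only [join]; grind
  · simp only [join]; grind

theorem join_insCap {D : Diagram n} {i : ℕ} {b c : Bool} (h1 : 1 ≤ i) (h : i ≤ n + 2)
    (x y : Fin (2 * n + 2)) :
    (insCap i b D).join (skip i x) (skip i y) c = insCap i b (D.join x y c) := by
  have hl := fun y => (skip_ne_lo (n := n) h1 h y).symm
  have hh := fun y => (skip_ne_hi (n := n) h1 h y).symm
  refine eq_insCap h1 h ?_ ?_ fun z => ?_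
  · simp [join, hl, insCap_mate_skip h1 h, insCap_mate_lo, insCap_dot_lo]
  · simp [join, hh, insCap_mate_skip h1 h, insCap_mate_hi h1 h, insCap_dot_hi]
  · simp only [join, skip_inj, insCap_mate_skip h1 h, insCap_dot_skip h1 h]
    simp only [apply_ite (skip i), and_self]

theorem toggle_join {D : Diagram n} (hD : D.IsDotted) {a b : Fin (2 * n + 2)} (ha : a ≠ 0)
    (hb : b ≠ 0) (hab : a ≠ b) (hab' : D.mate a ≠ b) (c : Bool) :
    (D.join a b c).toggle = D.toggle.join a b c := by
  have h0 := hD.mate_mate 0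
  have h1 := hD.mate_mate a
  have h2 := hD.mate_mate b
  ext k
  · rfl
  · have h3 := hD.mate_mate k
    have h4 := hD.mate_ne
    simp only [join, toggle]
    generalize D.dot a = da
    generalize D.dot b = db
    generalize D.dot k = dk
    cases da <;> cases db <;> cases dk <;> cases c <;>
      simp only [Bool.xor_true, Bool.xor_false, Bool.not_true, Bool.not_false] <;> grind

/-- Toggling after the join clears the dot of the new cap. The dot left on the merged strand is, on
the other side, the toggle of the strand through `0` made before the join. So a dotted generator
becomes an undotted one. -/
theorem toggle_join_zero {D : Diagram n} (hD : D.IsDotted) {b : Fin (2 * n + 2)}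
    (hb : b ≠ 0) (hab : D.mate 0 ≠ b) :
    (D.join 0 b true).toggle = D.toggle.join 0 b false := by
  have h0 := hD.mate_mate 0
  have h2 := hD.mate_mate b
  ext k
  · rfl
  · have h3 := hD.mate_mate k
    have := hD.mate_ne 0
    have := hD.mate_ne b
    simp only [join, toggle]
    generalize D.dot 0 = da
    generalize D.dot b = db
    generalize D.dot k = dk
    cases da <;> cases db <;> cases dk <;>
      simp only [Bool.xor_true, Bool.xor_false, Bool.not_true, Bool.not_false] <;> grind

/-- Straightening a zigzag. The generator at position `i` joins one end of the cap at `j` to the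
strand through the neighbouring point `u`; the other end of that cap takes over as the end of this
strand, and a cap at `i` is left. The merged strand collects the dots `b` and `c`. -/
theorem join_insCap_adjacent {D D' : Diagram n} (hD : D.IsDotted) (hm : D'.mate = D.mate)
    {i j : ℕ} (hi1 : 1 ≤ i) (hin : i ≤ n + 2) (hj1 : 1 ≤ j) (hjn : j ≤ n + 2) {b c : Bool}
    {u : Fin (2 * n + 2)} {v w : Fin (2 * (n + 1) + 2)}
    (hv : v = lo (n + 1) i ∧ w = hi (n + 1) i ∨ v = hi (n + 1) i ∧ w = lo (n + 1) i)
    (hu : skip j u = v)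
    (hw : w = lo (n + 1) j ∧ skip i u = hi (n + 1) j ∨ w = hi (n + 1) j ∧ skip i u = lo (n + 1) j)
    (hne : ∀ y, y ≠ u → skip j y = skip i y)
    (hd : D'.dot u = xor (xor (D.dot u) b) c)
    (hd' : ∀ y, y ≠ u → y ≠ D.mate u → D'.dot y = D.dot y) (hd2 : D'.dot (D.mate u) = D'.dot u) :
    (insCap j b D).join v w c = insCap i c D' := by
  have hmu := hD.mate_ne u
  have e1 : (insCap j b D).mate v = skip i (D.mate u) := by
    rw [← hu, insCap_mate_skip hj1 hjn, hne _ hmu]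
  have e2 : (insCap j b D).mate w = skip i u := by
    rcases hw with ⟨rfl, h⟩ | ⟨rfl, h⟩
    · rw [insCap_mate_lo, h]
    · rw [insCap_mate_hi hj1 hjn, h]
  have e3 : (insCap j b D).dot v = D.dot u := by rw [← hu, insCap_dot_skip hj1 hjn]
  have e4 : (insCap j b D).dot w = b := by
    rcases hw with ⟨rfl, h⟩ | ⟨rfl, h⟩
    · rw [insCap_dot_lo]
    · rw [insCap_dot_hi]
  have hl := lo_ne_hi (n := n + 1) hi1 hin
  have hsv : ∀ y : Fin (2 * n + 2), skip i y ≠ v := by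
    intro y
    rcases hv with ⟨rfl, _⟩ | ⟨rfl, _⟩
    exacts [skip_ne_lo hi1 hin y, skip_ne_hi hi1 hin y]
  have hsw : ∀ y : Fin (2 * n + 2), skip i y ≠ w := by
    intro y
    rcases hv with ⟨_, rfl⟩ | ⟨_, rfl⟩
    exacts [skip_ne_hi hi1 hin y, skip_ne_lo hi1 hin y]
  refine eq_insCap hi1 hin ?_ ?_ fun y => ?_
  · rcases hv with ⟨rfl, rfl⟩ | ⟨rfl, rfl⟩ <;> simp [join, hl]
  · rcases hv with ⟨rfl, rfl⟩ | ⟨rfl, rfl⟩ <;> simp [join, hl.symm]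
  · simp only [join, hsv, hsw, e1, e2, e3, e4, skip_inj, if_false, or_false, hm]
    by_cases hy : y = u
    · subst hy
      simp [hmu.symm, hd]
    by_cases hy' : y = D.mate u
    · subst hy'
      simp [hD.mate_mate, hd2, hd]
    · have h3 : D.mate y ≠ u := fun h => hy' (by rw [← h, hD.mate_mate])
      simp only [hy, hy', or_self, if_false, hd' y hy hy']
      rw [← hne y hy, insCap_mate_skip hj1 hjn, insCap_dot_skip hj1 hjn, hne _ h3]
      simp

/-- Two slots are far if their caps are disjoint. -/
def Far (s k : ℕ) : Prop := s ≠ k ∧ ¬ Adj s k ∧ ¬ (s ≤ 1 ∧ k ≤ 1)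

/-- The name of the slot `k` after deleting a cap at a slot `s` far from it. -/
def shift (s k : ℕ) : ℕ := if k < s then k else if k = 3 then s else k - 2

theorem Far.symm {s k : ℕ} (h : Far s k) : Far k s := by
  unfold Far Adj at *; omega

/-- The exceptional middle case: deleting a cap at position 1 moves position 3 to position 1, where
two slots compete. Deleting a dotted cap also toggles the left-most strand, so the undotted cap from
position 3 turns into a dotted one exactly when `s = 0`; its new slot is therefore `s`. -/
theorem Far.cases {s k : ℕ} (h : Far s k) :
    (k < s ∧ shift s k = k ∧ spos k + 1 < s ∧ spos s = s) ∨
      (s ≤ 1 ∧ k = 3 ∧ shift s k = s ∧ spos s = 1) ∨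
      (4 ≤ k ∧ shift s k = k - 2 ∧ spos s + 1 < k) := by
  unfold Far Adj at h
  unfold shift spos
  split_ifs <;> omega

theorem Far.spos_shift {s k : ℕ} (h : Far s k) :
    (spos (shift s k) + 1 < spos s ∧ spos k = spos (shift s k)) ∨
      (spos s ≤ spos (shift s k) ∧ spos k = spos (shift s k) + 2) := by
  rcases h.cases with h | h | h
  · left; rw [h.2.1]; omega
  · right; rw [h.2.2.1, h.2.1, h.2.2.2]; simp [spos]
  · right; rw [h.2.1]; unfold spos at *; omega

theorem Far.shift_le {s k : ℕ} (h : Far s k) (hs : s ≤ n + 2) (hk : k ≤ n + 1) :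
    shift s k ≤ n := by
  rcases h.cases with h | h | h
  · unfold spos at h; omega
  · have := h.2.2.1; omega
  · omega

theorem Far.shift_le' {s k : ℕ} (h : Far s k) (hs : s ≤ n + 2) (hk : k ≤ n + 2) :
    shift s k ≤ n + 1 := by
  rcases h.cases with h | h | h
  · have := h.2.2.1; unfold spos at this; omega
  · have := h.2.2.1; omega
  · omega

theorem Far.skip_lo {s k : ℕ} (h : Far s k) (hs : s ≤ n + 2) (hk' : k ≤ n + 2) :
    skip (spos s) (lo n (spos (shift s k))) = lo (n + 1) (spos k) := by
  have h1 := Diagram.spos_le (h.shift_le' hs hk')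
  have h2 := one_le_spos (shift s k)
  rw [Fin.ext_iff, val_skip, val_lo h1, val_lo (Diagram.spos_le hk')]
  rcases h.spos_shift with h | h <;> split_ifs <;> omega

theorem Far.skip_hi {s k : ℕ} (h : Far s k) (hs : s ≤ n + 2) (hk' : k ≤ n + 2) :
    skip (spos s) (hi n (spos (shift s k))) = hi (n + 1) (spos k) := by
  have h1 := Diagram.spos_le (h.shift_le' hs hk')
  have h2 := one_le_spos (shift s k)
  rw [Fin.ext_iff, val_skip, val_hi h1, val_hi (Diagram.spos_le hk')]
  rcases h.spos_shift with h | h <;> split_ifs <;> omega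

theorem left_eq (i : Fin (n + 1)) : left i = lo n (spos i) := by
  have h : (i : ℕ) ≤ n + 1 := i.2.le
  rw [Fin.ext_iff, val_lo (spos_le h)]; rfl

theorem right_eq (i : Fin (n + 1)) : right i = hi n (spos i) := by
  have h : (i : ℕ) ≤ n + 1 := i.2.le
  rw [Fin.ext_iff, val_hi (spos_le h)]; rfl

theorem hasCap_ins_of_far {s k : ℕ} {D : Diagram n} (h : Far s k) (hs : s ≤ n + 2)
    (hk : k ≤ n + 2) : (ins s D).HasCap (spos k) ↔ D.HasCap (spos (shift s k)) := by
  have h1 := h.shift_le' hs hk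
  rw [hasCap_iff (one_le_spos k) (spos_le hk), hasCap_iff (one_le_spos _) (spos_le h1),
    ← h.skip_lo hs hk, ← h.skip_hi hs hk, ins, insCap_mate_skip (one_le_spos s) (spos_le hs),
    skip_inj, twist_mate]

/-- The toggle meets the cap in question only for `s = 0`, `k = 3`, and there `shift 0 3 = 0`
accounts for it. -/
theorem Far.twist_dot {s k : ℕ} {D : Diagram n} (h : Far s k) (hs : s ≤ n + 2) (hk : k ≤ n + 2)
    (hD : D.IsDotted) (hc : D.HasCap (spos (shift s k))) :
    ((twist s D).dot (lo n (spos (shift s k))) = decide (k = 0)) ↔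
      D.dot (lo n (spos (shift s k))) = decide (shift s k = 0) := by
  have h1 := h.shift_le' hs hk
  by_cases hs0 : s = 0
  · subst hs0
    rcases h.cases with h2 | ⟨_, rfl, h2, _⟩ | h2
    · omega
    · have : lo n (spos (shift 0 3)) = 0 := by
        rw [Fin.ext_iff, val_lo (spos_le h1), h2]; rfl
      rw [this, h2]
      simp [twist, toggle]
    · rw [h2.2.1] at hc h1 ⊢
      have h3 : spos (k - 2) = k - 2 := by unfold spos; omega
      rw [h3] at hc ⊢
      rw [hasCap_iff (by omega) h1] at hc
      have h4 : lo n (k - 2) ≠ 0 := by rw [Ne, Fin.ext_iff, val_lo h1]; simpa using by omega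
      have h5 : lo n (k - 2) ≠ D.mate 0 := by
        intro h
        rw [h, hD.mate_mate, Fin.ext_iff, val_hi h1] at hc
        simp at hc; omega
      have h6 : ¬ k = 0 := by omega
      have h7 : ¬ k - 2 = 0 := by omega
      simp [twist, toggle, h4, h5, h6, h7]
  · have h3 : k = 0 ↔ shift s k = 0 := by
      rcases h.cases with h2 | h2 | h2
      · rw [h2.2.1]
      · rw [h2.2.2.1, h2.2.1]; omega
      · rw [h2.2.1]; omega
    simp [twist, hs0, h3]

theorem hasSlot_ins_of_far {s k : ℕ} {D : Diagram n} (h : Far s k) (hs : s ≤ n + 2)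
    (hk : k ≤ n + 2) (hD : D.IsDotted) : (ins s D).HasSlot k ↔ D.HasSlot (shift s k) := by
  have h1 := h.shift_le' hs hk
  have h2 := hasCap_ins_of_far (D := D) h hs hk
  by_cases hc : D.HasCap (spos (shift s k))
  · rw [hasSlot_iff hk, hasSlot_iff h1, ← hasCap_iff (one_le_spos k) (spos_le hk),
      ← hasCap_iff (one_le_spos _) (spos_le h1), h2, ← h.twist_dot hs hk hD hc,
      ← h.skip_lo hs hk, ins, insCap_dot_skip (one_le_spos s) (spos_le hs)]
  · exact iff_of_false (fun h => hc (h2.1 h.1)) (fun h => hc h.1)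

theorem attach_ins_of_far {s : ℕ} {k : Fin (n + 2)} {k' : Fin (n + 1)} {D : Diagram n}
    (h : Far s k) (hs : s ≤ n + 2) (hk' : (k' : ℕ) = shift s k) (hD : D.IsDotted)
    (hc : ¬ D.HasCap (pos k')) : (ins s D).attach k = ins s (D.attach k') := by
  have hk : (k : ℕ) ≤ n + 2 := by omega
  have hk1 : (k' : ℕ) ≤ n + 1 := by omega
  have hc' : D.mate (lo n (spos k')) ≠ hi n (spos k') := by
    rwa [Ne, ← hasCap_iff (one_le_spos _) (spos_le hk1)]
  rw [attach_eq_join, attach_eq_join, left_eq, right_eq, left_eq, right_eq, ← h.skip_lo hs hk,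
    ← h.skip_hi hs hk, ← hk', ins, ins, join_insCap (one_le_spos s) (spos_le hs)]
  congr 1
  have e0 : (k = 0) ↔ (k : ℕ) = 0 := by rw [Fin.ext_iff]; rfl
  have e0' : (k' = 0) ↔ (k' : ℕ) = 0 := by rw [Fin.ext_iff]; rfl
  by_cases hs0 : s = 0
  · subst hs0
    simp only [twist, if_true]
    rcases h.cases with h2 | ⟨_, h3, h2, _⟩ | h2
    · omega
    · have hk0 : (k' : ℕ) = 0 := by omega
      have hl : lo n (spos k') = 0 := by rw [Fin.ext_iff, val_lo (spos_le hk1), hk0]; rfl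
      have hh : hi n (spos k') ≠ 0 := by
        rw [Ne, Fin.ext_iff, val_hi (spos_le hk1), hk0]; simp [spos]
      rw [hl] at hc' ⊢
      rw [show decide (k = 0) = false by simp [e0, h3], show decide (k' = 0) = true by simp [e0', hk0]]
      -- Here `s = 0` and `k = 3`: the undotted `E_3` acts on the smaller diagram as the dotted
      -- `E_0`.
      exact (toggle_join_zero hD hh hc').symm
    · have h3 : spos k' = k' := by unfold spos; omega
      rw [h3] at hc' ⊢
      have hl : lo n k' ≠ 0 := by rw [Ne, Fin.ext_iff, val_lo (by omega)]; simpa using by omega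
      have hh : hi n k' ≠ 0 := by
        rw [Ne, Fin.ext_iff, val_hi (by omega)]; simpa using by omega
      rw [toggle_join hD hl hh (lo_ne_hi (by omega) (by omega)) hc']
      have h4 : ¬ (k : ℕ) = 0 := by omega
      have h5 : ¬ (k' : ℕ) = 0 := by omega
      simp only [e0, e0', h4, h5]
  · have h3 : (k : ℕ) = 0 ↔ (k' : ℕ) = 0 := by
      rw [hk']
      rcases h.cases with h2 | h2 | h2
      · rw [h2.2.1]
      · rw [h2.2.2.1, h2.2.1]; omega
      · rw [h2.2.1]; omega
    simp only [twist, hs0, if_false, e0, e0', h3]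

theorem attach_ins_of_adj {s : ℕ} {k : Fin (n + 2)} {D : Diagram n}
    (h : Adj s k) (hs : s ≤ n + 2) (hD : D.IsDotted) : (ins s D).attach k = ins k D := by
  have hk : (k : ℕ) ≤ n + 2 := by omega
  have hkn := k.2
  have e0 : (k = 0) ↔ (k : ℕ) = 0 := by rw [Fin.ext_iff]; rfl
  have hp := spos_le (m := n + 1) hs
  have hp' := spos_le (m := n + 1) hk
  have hq := one_le_spos s
  have hq' := one_le_spos k
  have hdec : decide (k = 0) = decide ((k : ℕ) = 0) := decide_eq_decide.2 e0
  have hd0 : ∀ (t : ℕ) (y : Fin (2 * n + 2)), ¬ (y = 0 ∨ y = D.mate 0) →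
      (twist t D).dot y = D.dot y := by
    intro t y hy; unfold twist; split_ifs; exacts [if_neg hy, rfl]
  have hd1 : ∀ (t : ℕ) (y : Fin (2 * n + 2)), (y = 0 ∨ y = D.mate 0) →
      (twist t D).dot y = xor (D.dot y) (decide (t = 0)) := by
    intro t y hy
    by_cases h : t = 0
    · rw [twist, if_pos h]; simp only [toggle, if_pos hy]; simp [h]
    · rw [twist, if_neg h]; simp [h]
  have hd2 : ∀ (t : ℕ), t ≠ 0 → twist t D = D := fun t ht => by simp [twist, ht]
  have hdm : ∀ (t : ℕ) (y : Fin (2 * n + 2)), (twist t D).dot (D.mate y) = (twist t D).dot y := by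
    intro t y
    have := (hD.twist (s := t)).dot_mate y
    rwa [twist_mate] at this
  rw [attach_eq_join, left_eq, right_eq, ins, ins, hdec]
  -- The two caps cover three consecutive points. Whichever cap is deleted, the one point not on it
  -- gets the same number `u`.
  obtain ⟨u, hu⟩ : ∃ u : Fin (2 * n + 2), (spos s = spos k + 1 ∧ (u : ℕ) + 1 = spos k) ∨
      (spos k = spos s + 1 ∧ (u : ℕ) + 1 = spos s) := by
    have h3 : spos s = spos k + 1 ∨ spos k = spos s + 1 := by unfold Adj at h; unfold spos; omega
    rcases h3 with h3 | h3
    · exact ⟨⟨spos k - 1, by omega⟩, Or.inl ⟨h3, by simp only; omega⟩⟩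
    · exact ⟨⟨spos s - 1, by omega⟩, Or.inr ⟨h3, by simp only; omega⟩⟩
  have hu0 : s = 0 ∨ (k : ℕ) = 0 → u = 0 := by
    intro h0
    rw [Fin.ext_iff]
    unfold Adj at h
    unfold spos at hu
    simp only [Fin.coe_ofNat_eq_mod, Nat.zero_mod]
    omega
  have hdu : (twist k D).dot u =
      xor (xor ((twist s D).dot u) (decide (s = 0))) (decide ((k : ℕ) = 0)) := by
    by_cases h0 : s = 0 ∨ (k : ℕ) = 0
    · rw [hd1 _ _ (Or.inl (hu0 h0)), hd1 _ _ (Or.inl (hu0 h0))]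
      cases D.dot u <;> cases decide (s = 0) <;> cases decide ((k : ℕ) = 0) <;> rfl
    · push Not at h0
      rw [hd2 _ h0.1, hd2 _ h0.2]
      simp [h0]
  have hdy : ∀ y, y ≠ u → y ≠ (twist s D).mate u → (twist k D).dot y = (twist s D).dot y := by
    intro y hy hy'
    by_cases h0 : s = 0 ∨ (k : ℕ) = 0
    · rw [twist_mate] at hy'
      rw [hu0 h0] at hy hy'
      rw [hd0 _ _ (by tauto), hd0 _ _ (by tauto)]
    · push Not at h0
      rw [hd2 _ h0.1, hd2 _ h0.2]
  have hm : (twist k D).mate = (twist s D).mate := by rw [twist_mate, twist_mate]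
  have hdm' : (twist k D).dot ((twist s D).mate u) = (twist k D).dot u := by rw [twist_mate, hdm]
  have hDs := hD.twist (s := s)
  have hskip : ∀ y, y ≠ u → skip (spos s) y = skip (spos k) y := by
    intro y hy
    rw [Ne, Fin.ext_iff] at hy
    rw [Fin.ext_iff, val_skip, val_skip]
    split_ifs <;> omega
  rcases hu with hu | hu
  · refine join_insCap_adjacent hDs hm hq' hp' hq hp (Or.inl ⟨rfl, rfl⟩) ?_ (Or.inl ⟨?_, ?_⟩)
      hskip hdu hdy hdm'
    · rw [Fin.ext_iff, val_skip, val_lo hp', if_pos] <;> omega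
    · rw [Fin.ext_iff, val_hi hp', val_lo hp]; omega
    · rw [Fin.ext_iff, val_skip, val_hi hp, if_neg] <;> omega
  · rw [join_comm (hDs.insCap hq hp ?_) (lo_ne_hi hq' hp')]
    · refine join_insCap_adjacent hDs hm hq' hp' hq hp (Or.inr ⟨rfl, rfl⟩) ?_ (Or.inr ⟨?_, ?_⟩)
        hskip hdu hdy hdm'
      · rw [Fin.ext_iff, val_skip, val_hi hp', if_neg] <;> omega
      · rw [Fin.ext_iff, val_lo hp', val_hi hp]; omega
      · rw [Fin.ext_iff, val_skip, val_lo hp, if_pos] <;> omega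
    · intro h0
      have : s = 0 := by simpa using h0
      rw [this]; rfl

/-- Far caps can be inserted in either order; only the toggle for `s = 0` needs care. If `t = 3`,
then `shift s t = 0`, and the outer toggle clears the dot of the inner cap, which becomes the
undotted cap at position 3. If `t ≥ 4`, both orders toggle the strand of `D` through its first
point. -/
theorem ins_ins {s t : ℕ} {D : Diagram n} (h : Far s t) (hst : s < t) (ht : t ≤ n + 3)
    (hD : D.IsDotted) : ins s (ins (shift s t) D) = ins t (ins s D) := by
  have hs : s ≤ n + 2 := by rcases h.cases with h | h | h <;> (unfold spos at h; omega)
  have h1 : shift s t ≤ n + 2 := h.shift_le' (by omega) ht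
  have hp := spos_le (m := n + 1) hs
  have hp' := spos_le (m := n + 2) ht
  have hps := spos_le (m := n + 2) (show s ≤ n + 3 by omega)
  have hq := one_le_spos s
  have hq' := one_le_spos t
  have hr := one_le_spos (shift s t)
  have hr' := spos_le (m := n + 1) h1
  have hts : Far t s := h.symm
  have hshift : shift t s = s := by simp [shift, hst]
  have ht3 : 3 ≤ t := by unfold Far Adj at h; omega
  have ht0 : t ≠ 0 := by omega
  have hi0 : s = 0 ↔ shift s t = 0 ∧ t = 3 ∨ s = 0 ∧ 4 ≤ t ∧ spos (shift s t) = t - 2 := by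
    rcases h.cases with h | h | h
    · omega
    · omega
    · have : spos (shift s t) = t - 2 := by rw [h.2.1]; unfold spos; omega
      omega
  have hσ0 : s ≠ 0 → shift s t ≠ 0 := by
    intro hs0
    rcases h.cases with h | h | h <;> omega
  have hE : (ins (shift s t) D).IsDotted := by
    refine hD.twist.insCap hr hr' fun h => ?_
    have : shift s t = 0 := by simpa using h
    rw [this]; rfl
  have hcap := (hasSlot_ins (D := D) h1).1
  have hdlo : (twist s (ins (shift s t) D)).dot (lo (n + 1) (spos (shift s t))) = false := by
    have := (h.twist_dot (n := n + 1) (by omega) ht hE hcap).2 insCap_dot_lo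
    rw [this]; simp [ht0]
  have hdhi : (twist s (ins (shift s t) D)).dot (hi (n + 1) (spos (shift s t))) = false := by
    have := (hE.twist (s := s)).dot_mate (lo (n + 1) (spos (shift s t)))
    rw [hdlo, twist_mate, ins, insCap_mate_lo] at this
    exact this
  have hlo := h.skip_lo (n := n + 1) (by omega) ht
  have hhi := h.skip_hi (n := n + 1) (by omega) ht
  have hlo' := hts.skip_lo (n := n + 1) ht (by omega)
  have hhi' := hts.skip_hi (n := n + 1) ht (by omega)
  rw [hshift] at hlo' hhi'
  have htf : decide (t = 0) = false := by simp [ht0]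
  have htw : twist t (ins s D) = ins s D := by simp [twist, ht0]
  symm
  rw [ins, htf, htw]
  rw [show ins s (ins (shift s t) D) =
    insCap (spos s) (decide (s = 0)) (twist s (ins (shift s t) D)) from rfl]
  refine eq_insCap hq hps ⟨?_, ?_⟩ ⟨?_, ?_⟩ fun y => ?_
  · rw [← hlo', insCap_mate_skip hq' hp', ins, insCap_mate_lo, hhi']
  · rw [← hlo', insCap_dot_skip hq' hp', ins, insCap_dot_lo]
  · rw [← hhi', insCap_mate_skip hq' hp', ins, insCap_mate_hi hq hp, hlo']
  · rw [← hhi', insCap_dot_skip hq' hp', ins, insCap_dot_hi]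
  · rcases lo_or_hi_or_skip hr hr' y with rfl | rfl | ⟨z, rfl⟩
    · rw [hlo, insCap_mate_lo, insCap_dot_lo, hdlo, twist_mate, ins, insCap_mate_lo, hhi]
      exact ⟨rfl, rfl⟩
    · rw [hhi, insCap_mate_hi hq' hp', insCap_dot_hi, hdhi, twist_mate, ins, insCap_mate_hi hr hr',
        hlo]
      exact ⟨rfl, rfl⟩
    · have hsk : ∀ z : Fin (2 * n + 2),
          skip (spos s) (skip (spos (shift s t)) z) = skip (spos t) (skip (spos s) z) := by
        intro z
        have := h.spos_shift
        have h5 : spos s < spos t := by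
          rcases h.cases with h | h | h
          · omega
          · rw [h.2.1, h.2.2.2]; decide
          · unfold spos at *; omega
        rw [Fin.ext_iff, val_skip, val_skip, val_skip, val_skip]
        split_ifs <;> omega
      rw [hsk, insCap_mate_skip hq' hp', insCap_dot_skip hq' hp', ins, insCap_mate_skip hq hp,
        insCap_dot_skip hq hp, twist_mate, twist_mate, ins, insCap_mate_skip hr hr', twist_mate, hsk]
      refine ⟨rfl, ?_⟩
      by_cases hs0 : s = 0
      · rcases hi0.1 hs0 with ⟨h6, h7⟩ | ⟨_, h6, h7⟩
        · have h8 : (skip (spos (shift s t)) z) ≠ 0 := by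
            rw [Ne, Fin.ext_iff, val_skip, h6]; simp [spos]
          have h9 : (skip (spos (shift s t)) z) ≠ hi (n + 1) (spos (shift s t)) :=
            skip_ne_hi hr hr' z
          have h10 : (0 : Fin (2 * (n + 1) + 2)) = lo (n + 1) (spos (shift s t)) := by
            rw [Fin.ext_iff, val_lo hr', h6]; rfl
          rw [twist, twist, if_pos hs0, if_pos hs0]
          conv_rhs => rw [toggle]
          simp only
          rw [if_neg, insCap_dot_skip hr hr', twist, if_pos h6]
          rw [h10, insCap_mate_lo, ← h10]
          tauto
        · have h10 : (0 : Fin (2 * (n + 1) + 2)) = skip (spos (shift s t)) 0 := by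
            rw [Fin.ext_iff, val_skip, h7]; simp; omega
          have h11 : shift s t ≠ 0 := by unfold spos at h7; omega
          rw [twist, twist, if_pos hs0, if_pos hs0, toggle, toggle]
          simp only
          rw [h10, insCap_mate_skip hr hr']
          simp only [skip_inj]
          rw [insCap_dot_skip hr hr', twist, if_neg h11]
      · rw [twist, if_neg hs0, twist, if_neg hs0, insCap_dot_skip hr hr', twist, if_neg (hσ0 hs0)]

end Diagram

open Diagram

/-! ### The module of even diagrams -/

variable {n : ℕ}

theorem eq_or_adj_or_far (s k : ℕ) :
    s = k ∨ (s ≠ k ∧ s ≤ 1 ∧ k ≤ 1) ∨ Adj s k ∨ Far s k := by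
  unfold Far; tauto

theorem Diagram.IsEven.hasCap_one {D : Diagram 0} (hD : D.IsEven) : D.HasCap 1 := by
  rw [hasCap_iff le_rfl (by omega)]
  have h := hD.mate_ne (lo 0 1)
  have h1 := (D.mate (lo 0 1)).2
  rw [Ne, Fin.ext_iff, val_lo (by omega)] at h
  rw [Fin.ext_iff, val_hi (by omega)]
  omega

/-- Remove an inner-most cap. As no loop arises, the generator is adjacent to it or far from it, and
in both cases the result is an insertion into an even diagram. -/
theorem Diagram.IsEven.attach {D : Diagram n} (hD : D.IsEven) {k : Fin (n + 1)}
    (hk : ¬ D.HasCap (pos k)) : (D.attach k).IsEven := by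
  induction n with
  | zero =>
    have : pos k = 1 := by unfold pos; omega
    rw [this] at hk
    exact absurd hD.hasCap_one hk
  | succ n ih =>
    obtain ⟨s, hs, D', hD', rfl⟩ := exists_eq_ins hD
    have hcap := (hasSlot_ins (D := D') hs).1
    rcases eq_or_adj_or_far s k with h | h | h | h
    · subst h; exact absurd hcap hk
    · have : spos s = pos k := by unfold spos pos; omega
      rw [this] at hcap; exact absurd hcap hk
    · rw [attach_ins_of_adj h hs hD'.isDotted]
      exact hD'.ins (by omega)
    · have hle := h.shift_le hs (by omega)
      have hk' : ¬ D'.HasCap (pos (⟨shift s k, by omega⟩ : Fin (n + 1))) :=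
        fun h' => hk ((hasCap_ins_of_far h hs (by omega)).2 h')
      rw [attach_ins_of_far (k' := ⟨shift s k, by omega⟩) h hs rfl hD'.isDotted hk']
      exact (ih hD' hk').ins hs

theorem isEven_one (n : ℕ) : (one n).IsEven := by
  refine ⟨fun a => Fin.rev_rev a, fun a h => ?_, fun a b hab hb => ?_, fun a => rfl,
    fun a h => absurd h (by simp [one]), by simp [numDots, one]⟩
  · have h1 := congrArg Fin.val h
    simp only [one, Fin.val_rev] at h1
    omega
  · exact Fin.rev_lt_rev.2 hab

theorem eq_one_of_isEven {D : Diagram 0} (hD : D.IsEven) : D = one 0 := by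
  have hm : D.mate = (one 0).mate := by
    funext a
    have h := hD.mate_ne a
    have h1 := (D.mate a).2
    have h2 := a.2
    rw [Ne, Fin.ext_iff] at h
    rw [Fin.ext_iff]
    simp only [one, Fin.val_rev]
    omega
  have h01 : D.mate 0 = 1 := by rw [hm]; rfl
  have hd1 : D.dot 1 = D.dot 0 := by rw [← h01, hD.dot_mate]
  have h0 : D.dot 0 = false := by
    by_contra h
    have h := Bool.eq_true_of_not_eq_false h
    have h2 := hD.even_dots
    have h3 : D.numDots = 1 := by
      rw [numDots_eq_sum, Fin.sum_univ_two]
      have : D.mate 1 = 0 := by rw [hm]; rfl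
      simp [h, h01, this]
    rw [h3] at h2
    exact absurd h2 (by decide)
  ext a
  · rw [hm]
  · have h2 : a = 0 ∨ a = 1 := by
      have h3 : (a : ℕ) = 0 ∨ (a : ℕ) = 1 := by omega
      rwa [Fin.ext_iff, Fin.ext_iff]
    rcases h2 with rfl | rfl
    · exact h0
    · exact hd1.trans h0

theorem one_succ (n : ℕ) : one (n + 1) = ins (n + 2) (one n) := by
  have h : spos (n + 2) = n + 2 := by unfold spos; omega
  have h1 : twist (n + 2) (one n) = one n := by simp [twist]
  rw [ins, h, h1]
  refine eq_insCap (by omega) le_rfl ⟨?_, rfl⟩ ⟨?_, rfl⟩ fun y => ⟨?_, rfl⟩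
  · rw [Fin.ext_iff, val_hi le_rfl]
    simp only [one, Fin.val_rev, val_lo le_rfl]; omega
  · rw [Fin.ext_iff, val_lo le_rfl]
    simp only [one, Fin.val_rev, val_hi le_rfl]; omega
  · have h2 := val_skip (n + 2) y
    have h3 : ((one n).mate y : ℕ) = 2 * n + 2 - (y + 1) := Fin.val_rev y
    have h4 : ((one (n + 1)).mate (skip (n + 2) y) : ℕ) =
      2 * (n + 1) + 2 - (skip (n + 2) y + 1) := Fin.val_rev _
    rw [Fin.ext_iff, val_skip, h4, h3, h2]
    by_cases h5 : (y : ℕ) + 1 < n + 2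
    · rw [if_pos h5, if_neg (by omega)]; omega
    · rw [if_neg h5, if_pos (by omega)]; omega

/-- The even diagrams. -/
abbrev EvenDiagram (n : ℕ) : Type := {D : Diagram n // D.IsEven}

/-- The identity diagram as an even diagram. -/
def oneE (n : ℕ) : EvenDiagram n := ⟨one n, isEven_one n⟩

/-- Insertion of a cap at the slot `s ≤ n + 2` of an even diagram. -/
def insE (s : ℕ) (D : EvenDiagram n) : EvenDiagram (n + 1) :=
  ⟨ins (min s (n + 2)) D.1, D.2.ins (min_le_right _ _)⟩

theorem insE_val {s : ℕ} (hs : s ≤ n + 2) (D : EvenDiagram n) : (insE s D).1 = ins s D.1 := by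
  simp only [insE, min_eq_left hs]

theorem insE_injective (s : ℕ) : Function.Injective (insE (n := n) s) := fun _ _ h =>
  Subtype.ext (ins_injective (min_le_right _ _) (congrArg Subtype.val h))

theorem exists_eq_insE (D : EvenDiagram (n + 1)) : ∃ s ≤ n + 2, ∃ D', D = insE s D' := by
  obtain ⟨s, hs, D', hD', h⟩ := exists_eq_ins D.2
  exact ⟨s, hs, ⟨D', hD'⟩, Subtype.ext (by rw [insE_val hs, h])⟩

theorem exists_eq_insE_of_hasSlot {D : EvenDiagram (n + 1)} {s : ℕ} (hs : s ≤ n + 2)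
    (h : D.1.HasSlot s) : ∃ D', D = insE s D' :=
  ⟨⟨del s D.1, D.2.del hs h⟩, Subtype.ext (by rw [insE_val hs, ins_del hs D.2.isDotted h])⟩

theorem hasSlot_insE {s : ℕ} (hs : s ≤ n + 2) (D : EvenDiagram n) : (insE s D).1.HasSlot s := by
  rw [insE_val hs]; exact hasSlot_ins hs

theorem hasSlot_insE_of_far {s k : ℕ} (h : Far s k) (hs : s ≤ n + 2) (hk : k ≤ n + 2)
    (D : EvenDiagram n) : (insE s D).1.HasSlot k ↔ D.1.HasSlot (shift s k) := by
  rw [insE_val hs]; exact hasSlot_ins_of_far h hs hk D.2.isDotted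

theorem insE_insE {s t : ℕ} (h : Far s t) (hs : s ≤ n + 3) (ht : t ≤ n + 3) (D : EvenDiagram n) :
    insE s (insE (shift s t) D) = insE t (insE (shift t s) D) := by
  wlog hst : s < t generalizing s t
  · exact (this h.symm ht hs (lt_of_le_of_ne (not_lt.1 hst) h.1.symm)).symm
  have h1 : shift t s = s := by simp [shift, hst]
  have h2 : shift s t ≤ n + 2 := h.shift_le' hs ht
  have h3 : s ≤ n + 2 := by omega
  ext1
  rw [h1, insE_val hs, insE_val h2, insE_val ht, insE_val h3, ins_ins h hst ht D.2.isDotted]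

/-- Formal linear combinations of even diagrams. -/
abbrev DiagModule (n : ℕ) : Type := EvenDiagram n →₀ K

open Classical in
/-- The diagram `D` times `E_k`, where diagrams with a closed dotted loop are zero. -/
def act (k : ℕ) (D : EvenDiagram n) : DiagModule n :=
  if h : D.1.HasCap (pos (Fin.ofNat (n + 1) k)) then
    if D.1.HasSlot k then Finsupp.single D (-qInt 2) else 0
  else Finsupp.single ⟨D.1.attach (Fin.ofNat (n + 1) k), D.2.attach h⟩ 1

/-- The linear extension of `act`. -/
def actL (k : ℕ) : DiagModule n →ₗ[K] DiagModule n := Finsupp.linearCombination K (act k)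

/-- The linear extension of `insE`. -/
def insL (s : ℕ) : DiagModule n →ₗ[K] DiagModule (n + 1) := Finsupp.lmapDomain K K (insE s)

@[simp] theorem actL_single (k : ℕ) (D : EvenDiagram n) (r : K) :
    actL k (Finsupp.single D r) = r • act k D := by simp [actL]

@[simp] theorem insL_single (s : ℕ) (D : EvenDiagram n) (r : K) :
    insL s (Finsupp.single D r) = Finsupp.single (insE s D) r := by simp [insL]

theorem ofNat_val {k : ℕ} (h : k ≤ n) : ((Fin.ofNat (n + 1) k : Fin (n + 1)) : ℕ) = k := by
  simp only [Fin.ofNat]; exact Nat.mod_eq_of_lt (by omega)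

theorem pos_ofNat {k : ℕ} (h : k ≤ n) : pos (Fin.ofNat (n + 1) k) = spos k := by
  rw [pos, ofNat_val h]; rfl

theorem act_of_hasSlot {k : ℕ} (h : k ≤ n) {D : EvenDiagram n} (hD : D.1.HasSlot k) :
    act k D = Finsupp.single D (-qInt 2) := by
  rw [act, dif_pos (by rw [pos_ofNat h]; exact hD.1), if_pos hD]

theorem act_of_not_hasSlot {k : ℕ} (h : k ≤ n) {D : EvenDiagram n} (hc : D.1.HasCap (spos k))
    (hD : ¬ D.1.HasSlot k) : act k D = 0 := by
  rw [act, dif_pos (by rw [pos_ofNat h]; exact hc), if_neg hD]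

theorem act_of_not_hasCap {k : Fin (n + 1)} {D : EvenDiagram n} (hc : ¬ D.1.HasCap (pos k)) :
    act k D = Finsupp.single ⟨D.1.attach k, D.2.attach hc⟩ 1 := by
  have : Fin.ofNat (n + 1) k = k := Fin.ext (ofNat_val (by omega))
  rw [act, dif_neg (by rwa [this])]
  simp only [this]

/-- The identity is the only even diagram with one strand. Its strand counts as an undotted cap at
position 1, while `E_0` is dotted, so the loop has one dot. -/
theorem act_diagram_zero {k : ℕ} (hk : k ≤ 0) (D : EvenDiagram 0) : act k D = 0 := by
  obtain rfl : k = 0 := by omega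
  refine act_of_not_hasSlot le_rfl D.2.hasCap_one fun h => ?_
  obtain ⟨a, _, h⟩ := h.2.2 rfl
  rw [eq_one_of_isEven D.2] at h
  exact absurd h (by simp [one])

/-! ### The four rules for a generator acting on a diagram with an inner-most cap -/

theorem act_self {k : ℕ} (hk : k ≤ n + 1) (D : EvenDiagram n) :
    act k (insE k D) = Finsupp.single (insE k D) (-qInt 2) :=
  act_of_hasSlot hk (hasSlot_insE (by omega) D)

theorem act_clash {s k : ℕ} (h : s ≠ k ∧ s ≤ 1 ∧ k ≤ 1) (D : EvenDiagram n) :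
    act k (insE s D) = 0 := by
  have h1 := hasSlot_insE (by omega : s ≤ n + 2) D
  have h2 : spos k = spos s := by unfold spos; omega
  refine act_of_not_hasSlot (by omega) (h2 ▸ h1.1) fun h3 => ?_
  have h4 := h1.2.symm.trans (h2 ▸ h3.2)
  omega

theorem not_hasCap_insE_of_adj {s k : ℕ} (h : Adj s k) (hs : s ≤ n + 2) (hk : k ≤ n + 1)
    (D : EvenDiagram n) : ¬ (insE s D).1.HasCap (spos k) := by
  have h1 := (hasSlot_insE hs D).1
  intro h2
  rw [hasCap_iff (one_le_spos _) (spos_le (by omega))] at h1 h2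
  have h3 := (insE s D).2.mate_mate
  have hp := spos_le (m := n + 1) hs
  have hp' := spos_le (m := n + 1) (by omega : k ≤ n + 1 + 1)
  have h4 : spos s = spos k + 1 ∨ spos k = spos s + 1 := by unfold Adj at h; unfold spos; omega
  rcases h4 with h4 | h4
  · have h5 : hi (n + 1) (spos k) = lo (n + 1) (spos s) := by
      rw [Fin.ext_iff, val_lo hp, val_hi hp']; omega
    have h6 := h3 (lo (n + 1) (spos k))
    rw [h2, h5, h1, Fin.ext_iff, val_hi hp, val_lo hp'] at h6
    omega
  · have h5 : hi (n + 1) (spos s) = lo (n + 1) (spos k) := by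
      rw [Fin.ext_iff, val_lo hp', val_hi hp]; omega
    have h6 := h3 (lo (n + 1) (spos s))
    rw [h1, h5, h2, Fin.ext_iff, val_hi hp', val_lo hp] at h6
    omega

theorem act_adj {s k : ℕ} (h : Adj s k) (hs : s ≤ n + 2) (hk : k ≤ n + 1) (D : EvenDiagram n) :
    act k (insE s D) = Finsupp.single (insE k D) 1 := by
  obtain ⟨k, rfl⟩ : ∃ k' : Fin (n + 2), k = k' := ⟨⟨k, by omega⟩, rfl⟩
  rw [act_of_not_hasCap (not_hasCap_insE_of_adj h hs hk D)]
  congr 1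
  ext1
  simp only [insE_val hs, insE_val (by omega : (k : ℕ) ≤ n + 2)]
  exact attach_ins_of_adj h hs D.2.isDotted

theorem act_far {s k : ℕ} (h : Far s k) (hs : s ≤ n + 2) (hk : k ≤ n + 1) (D : EvenDiagram n) :
    act k (insE s D) = insL s (act (shift s k) D) := by
  have hsh := h.shift_le hs hk
  have hcap := hasCap_ins_of_far (D := D.1) h hs (by omega)
  rw [← insE_val hs] at hcap
  have hslot := hasSlot_insE_of_far h hs (by omega) D
  by_cases hc : D.1.HasCap (spos (shift s k))
  · by_cases hd : D.1.HasSlot (shift s k)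
    · rw [act_of_hasSlot hk (hslot.2 hd), act_of_hasSlot hsh hd, insL_single]
    · rw [act_of_not_hasSlot hk (hcap.2 hc) (mt hslot.1 hd), act_of_not_hasSlot hsh hc hd, map_zero]
  · obtain ⟨k, rfl⟩ : ∃ k' : Fin (n + 2), k = k' := ⟨⟨k, by omega⟩, rfl⟩
    obtain ⟨l, hl⟩ : ∃ l : Fin (n + 1), shift s k = l := ⟨⟨shift s k, Nat.lt_succ_of_le hsh⟩, rfl⟩
    rw [hl] at hc hcap ⊢
    have hc' : ¬ (insE s D).1.HasCap (pos k) := mt hcap.1 hc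
    rw [act_of_not_hasCap hc', act_of_not_hasCap (k := l) hc, insL_single]
    congr 1
    ext1
    simp only [insE_val hs]
    exact attach_ins_of_far h hs hl.symm D.2.isDotted hc

theorem linearMap_ext_single {M : Type*} [AddCommGroup M] [Module K M] {f g : DiagModule n →ₗ[K] M}
    (h : ∀ D, f (Finsupp.single D 1) = g (Finsupp.single D 1)) : f = g :=
  Finsupp.lhom_ext' fun D => LinearMap.ext_ring (h D)

theorem actL_insL_self {k : ℕ} (hk : k ≤ n + 1) (v : DiagModule n) :
    actL k (insL k v) = (-qInt 2) • insL k v := by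
  refine LinearMap.congr_fun (f := actL k ∘ₗ insL k) (g := (-qInt 2) • insL k) ?_ v
  refine linearMap_ext_single fun D => ?_
  simp [act_self hk]

theorem actL_insL_clash {s k : ℕ} (h : s ≠ k ∧ s ≤ 1 ∧ k ≤ 1) (v : DiagModule n) :
    actL k (insL s v) = 0 := by
  refine LinearMap.congr_fun (f := actL k ∘ₗ insL s) (g := 0) ?_ v
  refine linearMap_ext_single fun D => ?_
  simp [act_clash h]

theorem actL_insL_adj {s k : ℕ} (h : Adj s k) (hs : s ≤ n + 2) (hk : k ≤ n + 1)
    (v : DiagModule n) : actL k (insL s v) = insL k v := by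
  refine LinearMap.congr_fun (f := actL k ∘ₗ insL s) (g := insL k) ?_ v
  refine linearMap_ext_single fun D => ?_
  simp [act_adj h hs hk]

theorem actL_insL_far {s k : ℕ} (h : Far s k) (hs : s ≤ n + 2) (hk : k ≤ n + 1)
    (v : DiagModule n) : actL k (insL s v) = insL s (actL (shift s k) v) := by
  refine LinearMap.congr_fun (f := actL k ∘ₗ insL s) (g := insL s ∘ₗ actL (shift s k)) ?_ v
  refine linearMap_ext_single fun D => ?_
  simp [act_far h hs hk]

theorem insL_insL {s t : ℕ} (h : Far s t) (hs : s ≤ n + 3) (ht : t ≤ n + 3) (v : DiagModule n) :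
    insL s (insL (shift s t) v) = insL t (insL (shift t s) v) := by
  refine LinearMap.congr_fun (f := insL s ∘ₗ insL (shift s t)) (g := insL t ∘ₗ insL (shift t s)) ?_ v
  refine linearMap_ext_single fun D => ?_
  simp [insE_insE h hs ht]

theorem actL_diagram_zero {k : ℕ} (hk : k ≤ 0) (v : DiagModule 0) : actL k v = 0 := by
  refine LinearMap.congr_fun (f := actL k) (g := 0) (linearMap_ext_single fun D => ?_) v
  simp [act_diagram_zero hk]

/-- A multiple of `E_k` ends in a cap at slot `k`. The relations can therefore be checked on vectors
in the image of `insL k`, where the four rules apply. -/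
theorem exists_act_eq {k : ℕ} (hk : k ≤ n + 1) (D : EvenDiagram (n + 1)) :
    ∃ v, act k D = insL k v := by
  induction n generalizing k with
  | zero =>
    obtain ⟨s, hs, D, rfl⟩ := exists_eq_insE D
    rcases eq_or_adj_or_far s k with rfl | h | h | h
    · exact ⟨Finsupp.single D (-qInt 2), by rw [act_self hk, insL_single]⟩
    · exact ⟨0, by rw [act_clash h, map_zero]⟩
    · exact ⟨Finsupp.single D 1, by rw [act_adj h hs hk, insL_single]⟩
    · exfalso; unfold Far Adj at h; omega
  | succ n ih =>
    obtain ⟨s, hs, D, rfl⟩ := exists_eq_insE D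
    rcases eq_or_adj_or_far s k with rfl | h | h | h
    · exact ⟨Finsupp.single D (-qInt 2), by rw [act_self hk, insL_single]⟩
    · exact ⟨0, by rw [act_clash h, map_zero]⟩
    · exact ⟨Finsupp.single D 1, by rw [act_adj h hs hk, insL_single]⟩
    · obtain ⟨v, hv⟩ := ih (h.shift_le hs hk) D
      exact ⟨insL (shift k s) v, by rw [act_far h hs hk, hv, insL_insL h hs (by omega)]⟩

theorem exists_actL_eq {k : ℕ} (hk : k ≤ n + 1) (v : DiagModule (n + 1)) :
    ∃ w, actL k v = insL k w := by
  induction v using Finsupp.induction_linear with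
  | zero => exact ⟨0, by simp⟩
  | add v w hv hw =>
    obtain ⟨v', hv⟩ := hv
    obtain ⟨w', hw⟩ := hw
    exact ⟨v' + w', by rw [map_add, map_add, hv, hw]⟩
  | single D r =>
    obtain ⟨v, hv⟩ := exists_act_eq hk D
    exact ⟨r • v, by rw [actL_single, hv, map_smul]⟩

/-! ### The defining relations hold on diagrams -/

theorem actL_sq {k : ℕ} (hk : k ≤ n) (v : DiagModule n) :
    actL k (actL k v) = (-qInt 2) • actL k v := by
  cases n with
  | zero => simp [actL_diagram_zero hk]
  | succ n =>
    obtain ⟨w, hw⟩ := exists_actL_eq hk v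
    rw [hw, actL_insL_self hk]

theorem actL_braid {j k : ℕ} (h : Adj j k) (hj : j ≤ n) (hk : k ≤ n) (v : DiagModule n) :
    actL j (actL k (actL j v)) = actL j v := by
  cases n with
  | zero => simp [actL_diagram_zero hj]
  | succ n =>
    obtain ⟨w, hw⟩ := exists_actL_eq hj v
    have h' : Adj k j := by unfold Adj at *; omega
    rw [hw, actL_insL_adj h (by omega) hk, actL_insL_adj h' (by omega) hj]

theorem Diagram.Far.far_shift {s j k : ℕ} (hj : Far s j) (hk : Far s k) (h : Far j k) :
    Far (shift s j) (shift s k) := by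
  have hj' := hj.cases
  have hk' := hk.cases
  generalize shift s j = j' at *
  generalize shift s k = k' at *
  unfold Far Adj at hj hk h ⊢
  unfold spos at *
  rcases hj' with hj' | hj' | hj' <;> rcases hk' with hk' | hk' | hk' <;> omega

/-- Moving a cap from slot `s` to slot `j` does not affect which generator of the smaller algebra
`E_k` becomes. -/
theorem Adj.shift_eq {s j k : ℕ} (h : Adj s j) (hs : Far s k) (hj : Far j k) :
    shift s k = shift j k := by
  have hj' := hj.cases
  have hs' := hs.cases
  generalize shift s k = k' at *
  generalize shift j k = k'' at *
  unfold Far at hj hs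
  unfold Adj spos at *
  rcases hj' with hj' | hj' | hj' <;> rcases hs' with hs' | hs' | hs' <;> omega

/-- Either `s = j` or `{s, j} = {0, 1}`, and the nodes `0` and `1` are far from the same nodes. -/
theorem Diagram.Far.far_of_not {s j k : ℕ} (h : Far j k) (h1 : ¬ Far s j) (h2 : ¬ Adj s j) : Far s k := by
  rcases eq_or_adj_or_far s j with rfl | h3 | h3 | h3
  · exact h
  · unfold Far Adj at *
    omega
  · exact absurd h3 h2
  · exact absurd h3 h1

theorem Adj.shift_symm {s j k : ℕ} (hj : Adj s j) (hk : Adj s k) (h : Far j k) :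
    shift j k = shift k j := by
  unfold Far Adj shift at *
  split_ifs <;> omega

theorem actL_comm_of_far {j k : ℕ} (h : Far j k) (hj : j ≤ n) (hk : k ≤ n) (v : DiagModule n) :
    actL j (actL k v) = actL k (actL j v) := by
  induction n generalizing j k with
  | zero => simp [actL_diagram_zero hj, actL_diagram_zero hk]
  | succ n ih =>
    refine LinearMap.congr_fun (f := actL j ∘ₗ actL k) (g := actL k ∘ₗ actL j) ?_ v
    refine linearMap_ext_single fun D => ?_
    obtain ⟨s, hs, D, rfl⟩ := exists_eq_insE D
    simp only [LinearMap.comp_apply, ← insL_single]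
    generalize (Finsupp.single D 1 : DiagModule n) = v
    -- One generator is not far from the cap, and they are not both adjacent to it. The situation is
    -- symmetric in `j` and `k`, so it is treated once.
    have half : ∀ {j k : ℕ}, Far j k → j ≤ n + 1 → k ≤ n + 1 → ¬ (Adj s j ∧ Adj s k) →
        ¬ (Far s j ∧ Far s k) → ¬ Far s j →
        actL j (actL k (insL s v)) = actL k (actL j (insL s v)) := by
      intro j k h hj hk h1 h2 h3
      rcases eq_or_adj_or_far s j with rfl | h5 | h5 | h5
      · rw [actL_insL_self hj, map_smul, actL_insL_far h hs hk, actL_insL_self hj]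
      · have h6 := h.far_of_not h3 (by unfold Adj; omega)
        rw [actL_insL_far h6 hs hk, actL_insL_clash h5, actL_insL_clash h5, map_zero]
      · have h6 : Far s k := by
          by_contra h6
          exact h1 ⟨h5, by
            by_contra h7
            have h8 := h.symm.far_of_not h6 h7
            exact h3 h8⟩
        rw [actL_insL_far h6 hs hk, actL_insL_adj h5 hs hj, actL_insL_adj h5 hs hj,
          actL_insL_far h (by omega) hk, h5.shift_eq h6 h]
      · exact absurd h5 h3
    by_cases h1 : Adj s j ∧ Adj s k
    · rw [actL_insL_adj h1.1 hs hj, actL_insL_adj h1.2 hs hk, actL_insL_far h (by omega) hk,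
        actL_insL_far h.symm (by omega) hj]
      -- Both generators pull at the same cap. Each side inserts two caps, in opposite orders, over
      -- one vector: that vector is hit by the same generator `shift j k = shift k j`, hence carries
      -- a cap at that slot.
      cases n with
      | zero => exfalso; unfold Far Adj at h; omega
      | succ n =>
        have h2 := h1.1.shift_symm h1.2 h
        obtain ⟨w, hw⟩ := exists_actL_eq (h.shift_le (by omega) hk) v
        rw [← h2, hw, insL_insL h (by omega) (by omega), h2]
    · by_cases h2 : Far s j ∧ Far s k
      · rw [actL_insL_far h2.1 hs hj, actL_insL_far h2.2 hs hk, actL_insL_far h2.1 hs hj,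
          actL_insL_far h2.2 hs hk, ih (h2.1.far_shift h2.2 h) (h2.1.shift_le hs hj)
          (h2.2.shift_le hs hk)]
      · by_cases h3 : Far s j
        · exact (half h.symm hk hj (by tauto) (by tauto) (by tauto)).symm
        · exact half h hj hk h1 h2 h3

/-- Besides far pairs only `{0, 1}` is new, and there both products contain a dotted loop and
vanish. -/
theorem actL_comm {j k : ℕ} (h : ¬ Adj j k) (hj : j ≤ n) (hk : k ≤ n) (v : DiagModule n) :
    actL j (actL k v) = actL k (actL j v) := by
  rcases eq_or_adj_or_far j k with rfl | h1 | h1 | h1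
  · rfl
  · cases n with
    | zero => simp [actL_diagram_zero hj, actL_diagram_zero hk]
    | succ n =>
      obtain ⟨w, hw⟩ := exists_actL_eq hj v
      obtain ⟨w', hw'⟩ := exists_actL_eq hk v
      rw [hw, hw', actL_insL_clash h1, actL_insL_clash ⟨h1.1.symm, h1.2.2, h1.2.1⟩]
  · exact absurd h1 h
  · exact actL_comm_of_far h1 hj hk v

/-! ### Homomorphisms out of the Temperley–Lieb algebra -/

/-- The universal property of the algebra `TL n`. -/
def lift {A : Type*} [Ring A] [Algebra K A] (f : Fin (n + 1) → A)
    (hsq : ∀ i, f i * f i = (-qInt 2) • f i)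
    (hbraid : ∀ i j : Fin (n + 1), Adj i j → f i * f j * f i = f i)
    (hcomm : ∀ i j : Fin (n + 1), ¬ Adj i j → f i * f j = f j * f i) : TL n →ₐ[K] A :=
  RingQuot.liftAlgHom K ⟨FreeAlgebra.lift K f, by
    rintro _ _ (i | ⟨i, j, hij⟩ | ⟨i, j, hij⟩)
    · simpa [neg_smul] using hsq i
    · simpa using hbraid i j hij
    · simpa using hcomm i j hij⟩

theorem lift_E {A : Type*} [Ring A] [Algebra K A] {f : Fin (n + 1) → A} (h1) (h2) (h3)
    (i : Fin (n + 1)) : lift f h1 h2 h3 (E i) = f i :=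
  (RingQuot.liftAlgHom_mkAlgHom_apply K _ _ _).trans (FreeAlgebra.lift_ι_apply _ _)

theorem incl_E {m : ℕ} (h : m ≤ n) (i : Fin (m + 1)) :
    incl h (E i) = E (Fin.castLE (Nat.succ_le_succ h) i) :=
  (RingQuot.liftAlgHom_mkAlgHom_apply K _ _ _).trans (FreeAlgebra.lift_ι_apply _ _)

theorem algHom_ext {A : Type*} [Ring A] [Algebra K A] {f g : TL n →ₐ[K] A}
    (h : ∀ i, f (E i) = g (E i)) : f = g := by
  refine RingQuot.ringQuot_ext' K f g ?_
  exact FreeAlgebra.hom_ext (funext h)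

/-- The right action of the algebra on the module of even diagrams. -/
def diagHom (n : ℕ) : TL n →ₐ[K] (Module.End K (DiagModule n))ᵐᵒᵖ :=
  lift (fun i => MulOpposite.op (actL (i : ℕ)))
    (fun i => by
      rw [← MulOpposite.op_mul, ← MulOpposite.op_smul]
      exact congrArg _ (LinearMap.ext fun v => actL_sq (by omega) v))
    (fun i j h => by
      rw [← MulOpposite.op_mul, ← MulOpposite.op_mul]
      exact congrArg _ (LinearMap.ext fun v => actL_braid h (by omega) (by omega) v))
    (fun i j h => by
      rw [← MulOpposite.op_mul, ← MulOpposite.op_mul]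
      exact congrArg _ (LinearMap.ext fun v => (actL_comm h (by omega) (by omega) v).symm))

/-- The image of an element of the algebra in the module of even diagrams. -/
def diag (x : TL n) : DiagModule n := (diagHom n x).unop (Finsupp.single (oneE n) 1)

theorem diag_add (x y : TL n) : diag (x + y) = diag x + diag y := by simp [diag]

theorem diag_smul (r : K) (x : TL n) : diag (r • x) = r • diag x := by simp [diag]

theorem diag_zero : diag (0 : TL n) = 0 := by simp [diag]

theorem diag_one : diag (1 : TL n) = Finsupp.single (oneE n) 1 := by simp [diag]

theorem diag_mul_E (x : TL n) (i : Fin (n + 1)) : diag (x * E i) = actL i (diag x) := by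
  simp [diag, diagHom, lift_E]

open Diagram

variable {n : ℕ}

/-! ### Descending products of generators -/

/-- The generator `E_k`, for `k ≤ n`. -/
def gen (k : ℕ) : TL n := E (Fin.ofNat (n + 1) k)

theorem E_eq_gen (i : Fin (n + 1)) : (E i : TL n) = gen i := by
  rw [gen, show Fin.ofNat (n + 1) (i : ℕ) = i from Fin.ext (ofNat_val (by omega))]

theorem gen_sq {k : ℕ} : (gen k : TL n) * gen k = (-qInt 2) • gen k := E_sq _

theorem gen_braid {j k : ℕ} (h : Adj j k) (hj : j ≤ n) (hk : k ≤ n) :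
    (gen j : TL n) * gen k * gen j = gen j :=
  E_braid (by rwa [ofNat_val hj, ofNat_val hk])

theorem gen_comm {j k : ℕ} (h : ¬ Adj j k) (hj : j ≤ n) (hk : k ≤ n) :
    (gen j : TL n) * gen k = gen k * gen j :=
  E_comm (by rwa [ofNat_val hj, ofNat_val hk])

theorem incl_gen {m k : ℕ} (h : m ≤ n) (hk : k ≤ m) : incl h (gen k) = gen k := by
  rw [gen, incl_E, E_eq_gen]
  rw [Fin.val_castLE, ofNat_val hk]

theorem diag_mul_gen {k : ℕ} (hk : k ≤ n) (x : TL n) : diag (x * gen k) = actL k (diag x) := by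
  rw [gen, diag_mul_E, ofNat_val hk]

/-- The product `E_M E_{M-1} ⋯` down to the slot `s`; it ends with `E_s` if `2 ≤ s ≤ M`, and with
`E_2 E_s` if `s ≤ 1`. -/
def desc : ℕ → ℕ → TL n
  | 0, _ => 1
  | M + 1, s => if M + 1 < s then 1 else if M = 0 then gen s else gen (M + 1) * desc M s

theorem desc_of_lt {M s : ℕ} (h : M < s) : (desc M s : TL n) = 1 := by
  cases M with
  | zero => rfl
  | succ M => rw [desc, if_pos h]

theorem desc_one {s : ℕ} (h : s ≤ 1) : (desc 1 s : TL n) = gen s := by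
  rw [desc, if_neg (by omega), if_pos rfl]

theorem desc_succ {M s : ℕ} (hM : 1 ≤ M) (h : s ≤ M + 1) :
    (desc (M + 1) s : TL n) = gen (M + 1) * desc M s := by
  rw [desc, if_neg (by omega), if_neg (by omega)]

theorem desc_self {M : ℕ} (hM : 1 ≤ M) : (desc M M : TL n) = gen M := by
  cases M with
  | zero => omega
  | succ M =>
    cases M with
    | zero => exact desc_one le_rfl
    | succ M => rw [desc_succ (by omega) le_rfl, desc_of_lt (by omega), mul_one]

/-- The first factor of `desc M s`. -/
def top (M s : ℕ) : ℕ := if M = 1 then s else M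

theorem desc_eq_top_mul {M s : ℕ} (hM : 1 ≤ M) (h : s ≤ M) :
    ∃ y : TL n, desc M s = gen (top M s) * y := by
  obtain ⟨M, rfl⟩ : ∃ m, M = m + 1 := ⟨M - 1, by omega⟩
  unfold top
  split_ifs with h1
  · exact ⟨1, by rw [h1, desc_one (by omega), mul_one]⟩
  · exact ⟨desc M s, desc_succ (by omega) h⟩

theorem gen_mul_desc {M s j : ℕ} (hM : 1 ≤ M) (hj : M + 2 ≤ j) (hjn : j ≤ n) :
    (gen j : TL n) * desc M s = desc M s * gen j := by
  induction M, hM using Nat.le_induction with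
  | base =>
    rcases Nat.lt_or_ge 1 s with h | h
    · rw [desc_of_lt h, mul_one, one_mul]
    · rw [desc_one h]
      exact gen_comm (by unfold Adj; omega) hjn (by omega)
  | succ M hM ih =>
    rcases Nat.lt_or_ge (M + 1) s with h | h
    · rw [desc_of_lt h, mul_one, one_mul]
    · rw [desc_succ hM h, ← mul_assoc, gen_comm (by unfold Adj; omega) hjn (by omega), mul_assoc,
        ih (by omega), mul_assoc]

theorem desc_mul_self {M s : ℕ} (hM : 1 ≤ M) (h : s ≤ M) :
    (desc M s : TL n) * gen s = (-qInt 2) • desc M s := by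
  induction M, hM using Nat.le_induction with
  | base => rw [desc_one h, gen_sq]
  | succ M hM ih =>
    rcases Nat.lt_or_ge M s with h1 | h1
    · obtain rfl : s = M + 1 := by omega
      rw [desc_self (by omega), gen_sq]
    · rw [desc_succ hM h, mul_assoc, ih h1, mul_smul_comm]

/-- The algebraic form of moving a cap to a neighbouring slot: away from `M` the product gets one
more factor, towards `M` a braid relation removes the last one. -/
theorem desc_mul_adj {M s k : ℕ} (hM : 1 ≤ M) (hMn : M ≤ n) (hs : s ≤ M + 1) (hk : k ≤ M)
    (h : Adj s k) : (desc M s : TL n) * gen k = desc M k := by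
  induction M, hM using Nat.le_induction with
  | base =>
    obtain rfl : s = 2 := by unfold Adj at h; omega
    rw [desc_of_lt (by omega), one_mul, desc_one hk]
  | succ M hM ih =>
    rcases Nat.lt_or_ge (M + 1) s with h1 | h1
    · obtain rfl : k = M + 1 := by unfold Adj at h; omega
      rw [desc_of_lt h1, one_mul, desc_self (by omega)]
    · rcases Nat.lt_or_ge M k with h2 | h2
      · obtain rfl : k = M + 1 := by omega
        have h3 : (desc M s : TL n) = gen s := by
          rcases Nat.lt_or_ge 1 M with h4 | h4
          · obtain rfl : s = M := by unfold Adj at h; omega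
            exact desc_self hM
          · obtain rfl : M = 1 := by omega
            exact desc_one (by unfold Adj at h; omega)
        rw [desc_succ hM h1, h3, desc_self (by omega)]
        exact gen_braid (by unfold Adj at *; omega) hMn (by omega)
      · rw [desc_succ hM h1, mul_assoc, ih (by omega) h1 h2, desc_succ hM hk]

theorem shift_eq_top {M s : ℕ} (hM : 1 ≤ M) (hs : s ≤ M) :
    shift s (M + 2) = top M s := by
  unfold shift top
  split_ifs <;> omega

/-- If `k < s`, all factors commute with `E_k`. If `s < k`, the factors above `E_k` still commute
with the resulting generator, which leaves the case where `E_k` is the first factor. -/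
theorem desc_mul_far {M s k : ℕ} (hM : 1 ≤ M) (hMn : M ≤ n) (hs : s ≤ M + 1) (hk : k ≤ M)
    (h : Far s k) : (desc M s : TL n) * gen k = gen (shift s k) * desc M s := by
  induction M, hM using Nat.le_induction with
  | base => exfalso; unfold Far Adj at h; omega
  | succ M hM ih =>
    rcases Nat.lt_or_ge (M + 1) s with h1 | h1
    · have h2 : shift s k = k := if_pos (by omega)
      rw [desc_of_lt h1, one_mul, mul_one, h2]
    · rcases Nat.lt_or_ge M k with h2 | h2
      · obtain rfl : k = M + 1 := by omega
        have hM2 : 2 ≤ M ∧ s ≤ M - 1 := by unfold Far Adj at h; omega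
        obtain ⟨m, rfl⟩ : ∃ m, M = m + 1 := ⟨M - 1, by omega⟩
        have hm : 1 ≤ m := by omega
        rw [shift_eq_top hm (by omega), desc_succ hM h1, desc_succ hm (by omega)]
        have ht : Adj (top m s) (m + 1) ∧ ¬ Adj (top m s) (m + 1 + 1) ∧ top m s ≤ m := by
          have hsm : s ≤ m := hM2.2
          have hn : (m = 1 ∧ top m s = s) ∨ (m ≠ 1 ∧ top m s = m) := by unfold top; split_ifs <;> simp_all
          generalize top m s = x at hn
          unfold Adj; omega
        obtain ⟨y, hy⟩ := desc_eq_top_mul (n := n) hm (by omega : s ≤ m)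
        -- `E_k E_{k-1} E_k` collapses to `E_k`, which loses `E_{k-1}`. Expanding the first factor
        -- `x` of the rest as `x E_{k-1} x` brings it back, and the left `x` moves past `E_k` to the
        -- front.
        calc (gen (m + 1 + 1) : TL n) * (gen (m + 1) * desc m s) * gen (m + 1 + 1)
            = gen (m + 1 + 1) * gen (m + 1) * (desc m s * gen (m + 1 + 1)) := by
              simp only [mul_assoc]
          _ = gen (m + 1 + 1) * gen (m + 1) * gen (m + 1 + 1) * desc m s := by
              rw [← gen_mul_desc hm le_rfl hMn]; simp only [mul_assoc]
          _ = gen (m + 1 + 1) * desc m s := by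
              rw [gen_braid (by unfold Adj; omega) hMn (by omega)]
          _ = gen (m + 1 + 1) * (gen (top m s) * gen (m + 1) * gen (top m s) * y) := by
              rw [gen_braid ht.1 (by omega) (by omega), hy]
          _ = gen (m + 1 + 1) * gen (top m s) * (gen (m + 1) * (gen (top m s) * y)) := by
              simp only [mul_assoc]
          _ = gen (top m s) * (gen (m + 1 + 1) * (gen (m + 1) * desc m s)) := by
              rw [← gen_comm ht.2.1 (by omega) hMn, ← hy]; simp only [mul_assoc]
      · have h3 : 2 ≤ M := by unfold Far Adj at h; omega
        obtain ⟨m, rfl⟩ : ∃ m, M = m + 1 := ⟨M - 1, by omega⟩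
        have h4 := h.shift_le (n := m) (by omega) h2
        rw [desc_succ hM h1, mul_assoc, ih (by omega) h1 h2, ← mul_assoc,
          gen_comm (by unfold Adj; omega) hMn (by omega), mul_assoc]

theorem Diagram.Far.succ {s t : ℕ} (h : Far s t) (hst : s < t) :
    Far s (t + 1) ∧ Adj (shift s (t + 1)) (shift s t) := by
  have h3 : 3 ≤ t := by unfold Far Adj at h; omega
  have h4 : shift s (t + 1) = t - 1 := by unfold shift; rw [if_neg, if_neg] <;> omega
  refine ⟨by unfold Far Adj at *; omega, ?_⟩
  rw [h4]
  unfold shift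
  rw [if_neg (by omega)]
  split_ifs
  · unfold Far Adj at *; omega
  · unfold Adj; omega

/-- The algebraic form of `ins_ins`. Induction downwards from `t = M + 2`: lowering `t` by one
multiplies both sides by `E_t` on the right. -/
theorem desc_mul_desc {M s t : ℕ} (hM : 1 ≤ M) (hMn : M + 1 ≤ n) (hst : s < t) (ht : t ≤ M + 2)
    (h : Far s t) :
    (desc M (shift s t) : TL n) * desc (M + 1) s = desc M s * desc (M + 1) t := by
  obtain ⟨d, hd⟩ : ∃ d, t + d = M + 2 := ⟨M + 2 - t, by omega⟩
  induction d generalizing t with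
  | zero =>
    obtain rfl : t = M + 2 := by omega
    have hs : s ≤ M := by unfold Far Adj at h; omega
    rw [shift_eq_top hM hs, desc_of_lt (by omega : M + 1 < M + 2), mul_one,
      desc_succ hM (by omega)]
    have ht : Adj (top M s) (M + 1) ∧ top M s ≤ M := by
      unfold top Adj; split_ifs <;> omega
    have h2 : (desc M (top M s) : TL n) = gen (top M s) := by
      unfold top
      split_ifs with h3
      · subst h3; exact desc_one hs
      · exact desc_self hM
    obtain ⟨y, hy⟩ := desc_eq_top_mul (n := n) hM hs
    rw [h2, hy, ← mul_assoc, ← mul_assoc, gen_braid ht.1 (by omega) hMn]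
  | succ d ih =>
    obtain ⟨h1, h2⟩ := h.succ hst
    have h3 := h.shift_le (n := M) (by omega) (by omega)
    have h4 := h1.shift_le' (n := M) (by omega) (by omega)
    rw [← desc_mul_adj (s := t + 1) (k := t) (by omega) hMn (by omega) (by omega)
        (by unfold Far Adj at *; omega), ← mul_assoc,
      ← ih (by omega) (by omega) h1 (by omega), mul_assoc,
      desc_mul_far (by omega) hMn (by omega) (by omega) h, ← mul_assoc,
      desc_mul_adj hM (by omega) h4 h3 h2]

theorem incl_desc {m M s : ℕ} (h : m ≤ n) (hM : M ≤ m) :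
    incl h (desc M s) = desc M s := by
  induction M with
  | zero => simp [desc]
  | succ M ih =>
    rcases Nat.lt_or_ge (M + 1) s with h1 | h1
    · rw [desc_of_lt h1, desc_of_lt h1, map_one]
    · rcases Nat.eq_zero_or_pos M with rfl | h2
      · rw [desc_one h1, desc_one h1, incl_gen h (by omega)]
      · rw [desc_succ h2 h1, desc_succ h2 h1, map_mul, incl_gen h hM, ih (by omega)]

/-! ### Normal forms of even diagrams -/

/-- The inclusion of `TL n` into `TL (n + 1)`. -/
abbrev up : TL n →ₐ[K] TL (n + 1) := incl (Nat.le_succ n)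

/-- An element of the algebra with a given even diagram. -/
def nf : ∀ n : ℕ, EvenDiagram n → TL n
  | 0, _ => 1
  | n + 1, D =>
    up (nf n (exists_eq_insE D).choose_spec.2.choose) * desc (n + 1) (exists_eq_insE D).choose

theorem exists_nf_eq (D : EvenDiagram (n + 1)) :
    ∃ s ≤ n + 2, ∃ D', D = insE s D' ∧ nf (n + 1) D = up (nf n D') * desc (n + 1) s :=
  ⟨(exists_eq_insE D).choose, (exists_eq_insE D).choose_spec.1,
    (exists_eq_insE D).choose_spec.2.choose, (exists_eq_insE D).choose_spec.2.choose_spec, rfl⟩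

theorem not_hasSlot_insE_of_clash {s k : ℕ} (h : s ≠ k ∧ s ≤ 1 ∧ k ≤ 1) (D : EvenDiagram n) :
    (insE s D).1.HasCap (spos k) ∧ ¬ (insE s D).1.HasSlot k := by
  have h1 := hasSlot_insE (by omega : s ≤ n + 2) D
  have h2 : spos k = spos s := by unfold spos; omega
  refine ⟨h2 ▸ h1.1, fun h3 => ?_⟩
  have h4 := h1.2.symm.trans (h2 ▸ h3.2)
  omega

theorem eq_or_far_of_insE_eq {s t : ℕ} (hs : s ≤ n + 2) (ht : t ≤ n + 2) {D D' : EvenDiagram n}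
    (h : insE s D = insE t D') : s = t ∨ Far s t := by
  have h1 := hasSlot_insE hs D
  have h2 := hasSlot_insE ht D'
  rcases eq_or_adj_or_far s t with h3 | h3 | h3 | h3
  · exact Or.inl h3
  · rw [← h] at h2
    exact absurd h2 (not_hasSlot_insE_of_clash h3 D).2
  · exfalso
    have h6 : t ≤ n + 1 ∨ s ≤ n + 1 := by unfold Adj at h3; omega
    rcases h6 with h6 | h6
    · rw [← h] at h2
      exact not_hasCap_insE_of_adj h3 hs h6 D h2.1
    · rw [h] at h1
      exact not_hasCap_insE_of_adj (by unfold Adj at *; omega) ht h6 D' h1.1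
  · exact Or.inr h3

theorem up_desc {M s : ℕ} (hM : M ≤ n) : up (desc M s : TL n) = desc M s := incl_desc _ hM

theorem up_gen {k : ℕ} (hk : k ≤ n) : up (gen k : TL n) = gen k := incl_gen _ hk

/-- The normal form does not depend on the cap removed first. Two different removable caps are far,
so the diagram comes from one with both caps removed, and `desc_mul_desc` compares the two orders.
-/
theorem nf_insE {s : ℕ} (hs : s ≤ n + 2) (D : EvenDiagram n) :
    nf (n + 1) (insE s D) = up (nf n D) * desc (n + 1) s := by
  induction n generalizing s with
  | zero =>
    obtain ⟨t, ht, D', h, h'⟩ := exists_nf_eq (insE s D)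
    rcases eq_or_far_of_insE_eq hs ht h with rfl | h1
    · rw [h', insE_injective s h]
    · exfalso; unfold Far Adj at h1; omega
  | succ n ih =>
    obtain ⟨t, ht, D', h, h'⟩ := exists_nf_eq (insE s D)
    rw [h']
    clear h'
    wlog hst : s < t generalizing s t D D'
    · rcases eq_or_far_of_insE_eq hs ht h with rfl | h1
      · rw [insE_injective s h]
      · exact (this ht D' s hs D h.symm (lt_of_le_of_ne (not_lt.1 hst) h1.1.symm)).symm
    have hF : Far s t := (eq_or_far_of_insE_eq hs ht h).resolve_left hst.ne
    have h1 := hF.shift_le' (n := n + 1) hs ht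
    have h2 : shift t s = s := if_pos hst
    have h3 : D.1.HasSlot (shift s t) := by
      rw [← hasSlot_insE_of_far hF hs ht, h]
      exact hasSlot_insE ht D'
    obtain ⟨D₂, rfl⟩ := exists_eq_insE_of_hasSlot h1 h3
    rw [insE_insE hF hs ht, h2] at h
    obtain rfl := insE_injective t h
    rw [ih (by omega), ih (by omega), map_mul, map_mul, up_desc le_rfl, up_desc le_rfl, mul_assoc,
      mul_assoc, desc_mul_desc (by omega) le_rfl hst ht hF]

/-- The linear extension of `nf`. -/
def nfL (n : ℕ) : DiagModule n →ₗ[K] TL n := Finsupp.linearCombination K (nf n)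

@[simp] theorem nfL_single (D : EvenDiagram n) (r : K) :
    nfL n (Finsupp.single D r) = r • nf n D := by simp [nfL]

theorem nfL_insL {s : ℕ} (hs : s ≤ n + 2) (v : DiagModule n) :
    nfL (n + 1) (insL s v) = up (nfL n v) * desc (n + 1) s := by
  refine LinearMap.congr_fun (f := nfL (n + 1) ∘ₗ insL s)
    (g := LinearMap.mulRight K (desc (n + 1) s) ∘ₗ up.toLinearMap ∘ₗ nfL n) ?_ v
  refine linearMap_ext_single fun D => ?_
  simp [nf_insE hs]

/-- The hypothesis excludes dotted loops: there the action is zero by definition, but the algebra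
has no such relation. -/
theorem nf_mul_gen {k : ℕ} (hk : k ≤ n) (D : EvenDiagram n)
    (h : D.1.HasCap (spos k) → D.1.HasSlot k) : nf n D * gen k = nfL n (act k D) := by
  induction n generalizing k with
  | zero =>
    exfalso
    obtain rfl : k = 0 := by omega
    obtain ⟨a, _, h⟩ := (h D.2.hasCap_one).2.2 rfl
    rw [eq_one_of_isEven D.2] at h
    exact absurd h (by simp [one])
  | succ n ih =>
    obtain ⟨s, hs, D, rfl⟩ := exists_eq_insE D
    rw [nf_insE hs, mul_assoc]
    rcases eq_or_adj_or_far s k with rfl | h1 | h1 | h1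
    · rw [act_self hk, desc_mul_self (by omega) hk, nfL_single, nf_insE hs, mul_smul_comm]
    · have := not_hasSlot_insE_of_clash h1 D
      exact absurd (h this.1) this.2
    · rw [act_adj h1 hs hk, desc_mul_adj (by omega) le_rfl hs hk h1, nfL_single,
        nf_insE (by omega), one_smul]
    · have h2 := h1.shift_le hs hk
      rw [hasSlot_insE_of_far h1 hs (by omega), insE_val hs,
        hasCap_ins_of_far h1 hs (by omega)] at h
      rw [act_far h1 hs hk, nfL_insL hs, ← ih h2 D h, desc_mul_far (by omega) le_rfl hs hk h1,
        map_mul, up_gen h2, mul_assoc]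

/-! ### The diagram of an element -/

theorem TL_induction {P : TL n → Prop} (h1 : ∀ r, P (algebraMap K _ r)) (hE : ∀ i, P (E i))
    (hm : ∀ x y, P x → P y → P (x * y)) (ha : ∀ x y, P x → P y → P (x + y)) (x : TL n) : P x := by
  obtain ⟨x, rfl⟩ := RingQuot.mkAlgHom_surjective K (Rel n) x
  induction x using FreeAlgebra.induction with
  | grade0 r => rw [AlgHom.commutes]; exact h1 r
  | grade1 i => exact hE i
  | mul x y hx hy => rw [map_mul]; exact hm _ _ hx hy
  | add x y hx hy => rw [map_add]; exact ha _ _ hx hy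

theorem diag_up_one : diag (up (1 : TL n)) = insL (n + 2) (diag (1 : TL n)) := by
  rw [map_one, diag_one, diag_one, insL_single]
  congr 1
  ext1
  rw [insE_val le_rfl]
  exact one_succ n

/-- The source must be at least `TL 1`: at level `0` the generator `E_0` has image zero, and one
level up it does not. -/
theorem diag_up (x : TL (n + 1)) : diag (up x) = insL (n + 3) (diag x) := by
  -- Generalised to right multiples so that the induction passes through products.
  have key : ∀ y : TL (n + 1), diag (up y) = insL (n + 3) (diag y) →
      diag (up (y * x)) = insL (n + 3) (diag (y * x)) := by
    induction x using TL_induction with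
    | h1 r =>
      intro y hy
      rw [Algebra.algebraMap_eq_smul_one, mul_smul_comm, mul_one, map_smul, diag_smul, diag_smul, hy,
        map_smul]
    | hE i =>
      intro y hy
      have hF : Far (n + 3) i := by unfold Far Adj; omega
      rw [E_eq_gen, map_mul, up_gen (by omega), diag_mul_gen (by omega), diag_mul_gen (by omega),
        hy, actL_insL_far hF le_rfl (by omega), shift, if_pos (by omega)]
    | hm x z hx hz =>
      intro y hy
      rw [← mul_assoc]
      exact hz _ (hx _ hy)
    | ha x z hx hz =>
      intro y hy
      rw [mul_add, map_add, diag_add, diag_add, hx _ hy, hz _ hy, map_add]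
  simpa using key 1 diag_up_one

/-- The factors of `desc M s` carry the cap from slot `M + 1` step by step to slot `s`. -/
theorem diag_mul_desc {M s : ℕ} (hM : 1 ≤ M) (hMn : M ≤ n + 1) (hs : s ≤ M + 1)
    {x : TL (n + 1)} {v : DiagModule n} (hx : diag x = insL (M + 1) v) :
    diag (x * desc M s) = insL s v := by
  induction M, hM using Nat.le_induction generalizing x with
  | base =>
    rcases Nat.lt_or_ge 1 s with h | h
    · obtain rfl : s = 2 := by omega
      rw [desc_of_lt h, mul_one, hx]
    · rw [desc_one h, diag_mul_gen (by omega), hx,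
        actL_insL_adj (by unfold Adj; omega) (by omega) (by omega)]
  | succ M hM ih =>
    rcases Nat.lt_or_ge (M + 1) s with h | h
    · obtain rfl : s = M + 2 := by omega
      rw [desc_of_lt h, mul_one, hx]
    · rw [desc_succ hM h, ← mul_assoc]
      refine ih (by omega) h ?_
      rw [diag_mul_gen hMn, hx, actL_insL_adj (by unfold Adj; omega) (by omega) hMn]

theorem diag_nf (D : EvenDiagram n) : diag (nf n D) = Finsupp.single D 1 := by
  induction n with
  | zero =>
    have : D = oneE 0 := Subtype.ext (eq_one_of_isEven D.2)
    rw [nf, diag_one, this]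
  | succ n ih =>
    obtain ⟨s, hs, D, rfl⟩ := exists_eq_insE D
    rw [nf_insE hs, diag_mul_desc (v := diag (nf n D)) (by omega) le_rfl hs, ih, insL_single]
    cases n with
    | zero => exact diag_up_one
    | succ n => exact diag_up _

/-! ### Words -/

theorem word_append (w v : List (Fin (n + 1))) : (word (w ++ v) : TL n) = word w * word v := by
  simp [word]

theorem word_snoc (w : List (Fin (n + 1))) (i : Fin (n + 1)) :
    (word (w ++ [i]) : TL n) = word w * E i := by
  simp [word]

theorem exists_word_mul {x y : TL n} (hx : ∃ w, word w = x) (hy : ∃ w, word w = y) :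
    ∃ w, word w = x * y := by
  obtain ⟨w, rfl⟩ := hx
  obtain ⟨v, rfl⟩ := hy
  exact ⟨w ++ v, word_append w v⟩

theorem exists_word_gen (k : ℕ) : ∃ w, word w = (gen k : TL n) := ⟨[Fin.ofNat (n + 1) k], by simp [word, gen]⟩

theorem exists_word_desc (M s : ℕ) : ∃ w, word w = (desc M s : TL n) := by
  induction M with
  | zero => exact ⟨[], rfl⟩
  | succ M ih =>
    rw [desc]
    split_ifs
    · exact ⟨[], rfl⟩
    · exact exists_word_gen _
    · exact exists_word_mul (exists_word_gen _) ih

theorem exists_word_up {x : TL n} (hx : ∃ w, word w = x) : ∃ w, word w = up x := by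
  obtain ⟨w, rfl⟩ := hx
  refine ⟨w.map (Fin.castLE (by omega)), ?_⟩
  rw [word, word, map_list_prod, List.map_map, List.map_map]
  congr 1
  refine List.map_congr_left fun i _ => ?_
  exact (incl_E _ i).symm

theorem exists_word_nf (D : EvenDiagram n) : ∃ w, word w = nf n D := by
  induction n with
  | zero => exact ⟨[], rfl⟩
  | succ n ih =>
    obtain ⟨s, hs, D, rfl⟩ := exists_eq_insE D
    rw [nf_insE hs]
    exact exists_word_mul (exists_word_up (ih D)) (exists_word_desc _ _)

theorem Diagram.Draws.word_eq {w : List (Fin (n + 1))} {D : Diagram n} (h : Draws w D) :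
    ∃ hD : D.IsEven, (word w : TL n) = nf n ⟨D, hD⟩ := by
  induction h with
  | nil =>
    refine ⟨isEven_one n, ?_⟩
    clear * -
    change (1 : TL n) = nf n (oneE n)
    induction n with
    | zero => rfl
    | succ n ih =>
      have h1 : oneE (n + 1) = insE (n + 2) (oneE n) :=
        Subtype.ext (by rw [insE_val le_rfl]; exact one_succ n)
      rw [h1, nf_insE le_rfl, ← ih, desc_of_lt (by omega), map_one, mul_one]
  | snoc w D i _ hi ih =>
    obtain ⟨hD, ih⟩ := ih
    refine ⟨hD.attach hi, ?_⟩
    rw [word_snoc, ih, E_eq_gen, nf_mul_gen (by omega) _ fun h => absurd h hi,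
      act_of_not_hasCap (D := ⟨D, hD⟩) hi, nfL_single, one_smul]

theorem IsReduced.of_snoc {w : List (Fin (n + 1))} {i : Fin (n + 1)} (h : IsReduced (w ++ [i])) :
    IsReduced w := by
  intro v r hv
  have := h (v ++ [i]) r (by rw [word_snoc, word_snoc, hv, smul_mul_assoc])
  simpa using this

/-- Add letters one at a time. A loop without a dot would make the word a multiple of a shorter one;
a dotted loop makes the image zero, and it stays zero. -/
theorem IsReduced.diag_eq_zero_or_draws {w : List (Fin (n + 1))} (h : IsReduced w) :
    diag (word w) = 0 ∨ ∃ D, Draws w D := by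
  induction w using List.reverseRecOn with
  | nil => exact Or.inr ⟨_, Draws.nil⟩
  | append_singleton w i ih =>
    rcases ih h.of_snoc with h1 | ⟨D, h1⟩
    · left; rw [word_snoc, diag_mul_E, h1, map_zero]
    · by_cases hc : D.HasCap (pos i)
      · left
        obtain ⟨hD, h2⟩ := h1.word_eq
        by_cases hs : D.HasSlot i
        · exfalso
          have h3 : (word (w ++ [i]) : TL n) = (-qInt 2) • word w := by
            rw [word_snoc, h2, E_eq_gen, nf_mul_gen (by omega) _ fun _ => hs,
              act_of_hasSlot (by omega) hs, nfL_single]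
          have := h w _ h3
          simp at this
        · rw [word_snoc, diag_mul_E, h2, diag_nf, actL_single,
            act_of_not_hasSlot (by omega) hc hs, smul_zero]
      · exact Or.inr ⟨_, Draws.snoc w D i h1 hc⟩

/-- Take a shortest word whose element is a nonzero multiple of the normal form. It is reduced with
nonzero image, so it draws a diagram, which `diag` identifies. -/
theorem exists_isReduced_draws (D : EvenDiagram n) : ∃ w, IsReduced w ∧ Draws w D.1 := by
  have hex : ∃ l : ℕ, ∃ w : List (Fin (n + 1)), w.length = l ∧
      ∃ r : K, r ≠ 0 ∧ word w = r • nf n D := by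
    obtain ⟨w, hw⟩ := exists_word_nf D
    exact ⟨_, w, rfl, 1, one_ne_zero, by rw [hw, one_smul]⟩
  classical
  obtain ⟨w, hl, r, hr, hw⟩ := Nat.find_spec hex
  have hdiag : diag (word w) = Finsupp.single D r := by
    rw [hw, diag_smul, diag_nf, Finsupp.smul_single, smul_eq_mul, mul_one]
  have hne : diag (word w) ≠ 0 := by rw [hdiag]; simpa using hr
  have hred : IsReduced w := by
    intro v r' hv
    rw [hl]
    have hr' : r' ≠ 0 := by
      rintro rfl
      rw [hv, zero_smul, diag_zero] at hne
      exact hne rfl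
    refine Nat.find_min' hex ⟨v, rfl, r'⁻¹ * r, mul_ne_zero (inv_ne_zero hr') hr, ?_⟩
    rw [mul_smul, ← hw, hv, smul_smul, inv_mul_cancel₀ hr', one_smul]
  refine ⟨w, hred, ?_⟩
  rcases hred.diag_eq_zero_or_draws with h | ⟨D', h⟩
  · exact absurd h hne
  · obtain ⟨hD', h'⟩ := h.word_eq
    rw [h', diag_nf] at hdiag
    rcases (Finsupp.single_eq_single_iff _ _ _ _).1 hdiag with h1 | h1
    · rw [← h1.1]; exact h
    · exact absurd h1.1 one_ne_zero

theorem mem_span_word (x : TL n) : x ∈ Submodule.span K (Set.range (word (n := n))) := by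
  have key : ∀ y ∈ Submodule.span K (Set.range (word (n := n))),
      y * x ∈ Submodule.span K (Set.range (word (n := n))) := by
    induction x using TL_induction with
    | h1 r =>
      intro y hy
      rw [Algebra.algebraMap_eq_smul_one, mul_smul_comm, mul_one]
      exact Submodule.smul_mem _ _ hy
    | hE i =>
      intro y hy
      induction hy using Submodule.span_induction with
      | mem y hy =>
        obtain ⟨w, rfl⟩ := hy
        exact Submodule.subset_span ⟨w ++ [i], word_snoc w i⟩
      | zero => simp
      | add y z _ _ hy hz => rw [add_mul]; exact add_mem hy hz
      | smul r y _ hy => rw [smul_mul_assoc]; exact Submodule.smul_mem _ _ hy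
    | hm x z hx hz => intro y hy; rw [← mul_assoc]; exact hz _ (hx _ hy)
    | ha x z hx hz => intro y hy; rw [mul_add]; exact add_mem (hx _ hy) (hz _ hy)
  simpa using key 1 (Submodule.subset_span ⟨[], rfl⟩)

theorem exists_isReduced_smul (w : List (Fin (n + 1))) :
    ∃ v, IsReduced v ∧ ∃ r : K, (word w : TL n) = r • word v := by
  induction h : w.length using Nat.strong_induction_on generalizing w with
  | _ l ih =>
    by_cases hw : IsReduced w
    · exact ⟨w, hw, 1, (one_smul _ _).symm⟩
    · unfold IsReduced at hw
      push Not at hw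
      obtain ⟨v, r, hv, hlt⟩ := hw
      obtain ⟨u, hu, r', hr'⟩ := ih v.length (by omega) v rfl
      exact ⟨u, hu, r * r', by rw [hv, hr', smul_smul]⟩

theorem mem_span_reduced (x : TL n) :
    x ∈ Submodule.span K {y : TL n | ∃ w, IsReduced w ∧ word w = y} := by
  refine Submodule.span_le.2 ?_ (mem_span_word x)
  rintro _ ⟨w, rfl⟩
  obtain ⟨v, hv, r, h⟩ := exists_isReduced_smul w
  rw [h]
  exact Submodule.smul_mem _ _ (Submodule.subset_span ⟨v, hv, rfl⟩)

open Classical in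
theorem diag_reduced_apply {y : TL n} (hy : ∃ w, IsReduced w ∧ word w = y) (D : EvenDiagram n) :
    diag y D = if y = nf n D then 1 else 0 := by
  split_ifs with h
  · rw [h, diag_nf, Finsupp.single_eq_same]
  · obtain ⟨w, hw, rfl⟩ := hy
    rcases hw.diag_eq_zero_or_draws with h1 | ⟨D', h1⟩
    · rw [h1]; rfl
    · obtain ⟨hD', h2⟩ := h1.word_eq
      rw [h2, diag_nf, Finsupp.single_apply, if_neg]
      rintro rfl
      exact h h2

/-- The linear form taking the coefficient at an even diagram. -/
def diagCoef (D : EvenDiagram n) : TL n →ₗ[K] K where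
  toFun x := diag x D
  map_add' x y := by rw [diag_add]; rfl
  map_smul' r x := by rw [diag_smul]; rfl

/-- On reduced elements, the `D`-entry of `diag` is the indicator of `nf n D`. Hence it reads off
the same coefficient from every expansion. -/
theorem isCoef_iff (x : TL n) (D : EvenDiagram n) (r : K) : IsCoef x D.1 r ↔ r = diag x D := by
  classical
  have key : ∀ a : TL n →₀ K, (∀ y ∈ a.support, ∃ w, IsReduced w ∧ word w = y) →
      (a.sum fun y s => s • y) = x → diag x D = a (nf n D) := by
    rintro a ha rfl
    change diagCoef D _ = _
    rw [Finsupp.sum, map_sum]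
    have : ∀ y ∈ a.support, diagCoef D (a y • y) = if y = nf n D then a y else 0 := by
      intro y hy
      rw [map_smul]
      change a y • diag y D = _
      rw [diag_reduced_apply (ha y hy)]
      split_ifs <;> simp
    rw [Finset.sum_congr rfl this, Finset.sum_ite_eq']
    split_ifs with h
    · rfl
    · exact (Finsupp.notMem_support_iff.1 h).symm
  constructor
  · rintro ⟨a, ha, hx, w, _, hw, rfl⟩
    obtain ⟨_, h⟩ := hw.word_eq
    rw [h, key a ha hx]
  · rintro rfl
    obtain ⟨a, ha, hx⟩ := Submodule.mem_span_set.1 (mem_span_reduced x)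
    obtain ⟨w, hw, hD⟩ := exists_isReduced_draws D
    refine ⟨a, fun y hy => ha hy, hx, w, hw, hD, ?_⟩
    obtain ⟨_, h⟩ := hD.word_eq
    rw [h, key a (fun y hy => ha hy) hx]

/-! ### Quantum integers -/

theorem q_pow_ne_one {m : ℕ} (hm : m ≠ 0) : q ^ m ≠ 1 := by
  intro h
  have h1 : (algebraMap (Polynomial ℂ) K) (Polynomial.X ^ m) =
      algebraMap (Polynomial ℂ) K 1 := by
    rw [map_pow, map_one, RatFunc.algebraMap_X]; exact h
  have h2 := congrArg Polynomial.natDegree (RatFunc.algebraMap_injective ℂ h1)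
  simp at h2
  exact hm h2

theorem q_ne_zero : q ≠ 0 := RatFunc.X_ne_zero

theorem sub_inv_ne_zero {m : ℕ} (hm : m ≠ 0) : q ^ m - (q ^ m)⁻¹ ≠ 0 := by
  intro h
  have h0 : q ^ m ≠ 0 := pow_ne_zero _ q_ne_zero
  have h1 : q ^ m * q ^ m = 1 := by
    rw [sub_eq_zero] at h
    nth_rewrite 1 [h]
    exact inv_mul_cancel₀ h0
  rw [← pow_add] at h1
  exact q_pow_ne_one (by omega) h1

theorem q_sub_inv_ne_zero : q - q⁻¹ ≠ 0 := by simpa using sub_inv_ne_zero one_ne_zero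

theorem qInt_ne_zero {m : ℕ} (hm : m ≠ 0) : qInt m ≠ 0 :=
  div_ne_zero (sub_inv_ne_zero hm) q_sub_inv_ne_zero

theorem qInt_zero : qInt 0 = 0 := by simp [qInt]

theorem qInt_one : qInt 1 = 1 := by simp [qInt, q_sub_inv_ne_zero]

theorem qInt_two_mul (m : ℕ) : qInt (2 * m) = qInt m * (q ^ m + (q ^ m)⁻¹) := by
  have h0 : q ^ m ≠ 0 := pow_ne_zero _ q_ne_zero
  rw [qInt, qInt, two_mul, pow_add, div_mul_eq_mul_div]
  congr 1
  field_simp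
  ring

theorem qInt_two : qInt 2 = q + q⁻¹ := by
  have := qInt_two_mul 1
  rwa [qInt_one, one_mul, pow_one] at this

theorem qInt_recurrence (m : ℕ) : qInt m - qInt 2 * qInt (m + 1) + qInt (m + 2) = 0 := by
  have h0 := q_ne_zero
  have h1 := q_sub_inv_ne_zero
  have h2 : q ^ m ≠ 0 := pow_ne_zero _ h0
  rw [qInt_two, qInt, qInt, qInt, pow_add, pow_add, mul_div_assoc', ← sub_div, ← add_div,
    div_eq_zero_iff]
  left
  field_simp
  ring

/-- The ratio of `coefG N i` and `[N] / [2N]`. -/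
theorem coefG_eq {N i : ℕ} (hi : 2 ≤ i) :
    coefG N i = qInt N / qInt (2 * N) * (q ^ (i - 1) + (q ^ (i - 1))⁻¹) := by
  have h1 : 2 * i - 2 = 2 * (i - 1) := by omega
  have h2 : qInt (i - 1) ≠ 0 := qInt_ne_zero (by omega)
  rw [coefG, if_neg (by omega), h1, qInt_two_mul]
  field_simp

/-- The coefficient of the product `desc N s` in the recursion for the projections. -/
def slotCoef (N s : ℕ) : K := coefG N (spos s)

theorem slotCoef_of_le_one {N s : ℕ} (hs : s ≤ 1) : slotCoef N s = qInt N / qInt (2 * N) := by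
  have : spos s = 1 := by unfold spos; omega
  rw [slotCoef, this, coefG, if_pos rfl]

theorem slotCoef_of_two_le {N s : ℕ} (hs : 2 ≤ s) :
    slotCoef N s = qInt N / qInt (2 * N) * (q ^ (s - 1) + (q ^ (s - 1))⁻¹) := by
  have : spos s = s := by unfold spos; omega
  rw [slotCoef, this, coefG_eq hs]

theorem slotCoef_two (N : ℕ) : slotCoef N 2 = qInt 2 * slotCoef N 1 := by
  rw [slotCoef_of_two_le le_rfl, slotCoef_of_le_one le_rfl, qInt_two]; simp [mul_comm]

/-- Up to a common factor the coefficient at position `i` is `q ^ (i-1) + q ^ (1-i)`. At `i = 1`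
this is `2`, shared equally by the slots `0` and `1`; their sum continues the recurrence past the
fork of the Dynkin diagram. -/
theorem slotCoef_three (N : ℕ) :
    slotCoef N 0 + slotCoef N 1 - qInt 2 * slotCoef N 2 + slotCoef N 3 = 0 := by
  have h0 := q_ne_zero
  rw [slotCoef_of_two_le (le_refl 2), slotCoef_of_two_le (by omega : 2 ≤ 3),
    slotCoef_of_le_one (le_refl 1), slotCoef_of_le_one zero_le_one, qInt_two]
  simp only [Nat.reduceSub]
  field_simp
  ring

theorem slotCoef_recurrence {N s : ℕ} (hs : 2 ≤ s) :
    slotCoef N s - qInt 2 * slotCoef N (s + 1) + slotCoef N (s + 2) = 0 := by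
  obtain ⟨m, rfl⟩ : ∃ m, s = m + 1 := ⟨s - 1, by omega⟩
  have h0 := q_ne_zero
  have h2 : q ^ m ≠ 0 := pow_ne_zero _ h0
  rw [slotCoef_of_two_le hs, slotCoef_of_two_le (by omega), slotCoef_of_two_le (by omega), qInt_two,
    show m + 1 - 1 = m by omega, show m + 1 + 1 - 1 = m + 1 by omega,
    show m + 1 + 2 - 1 = m + 2 by omega, pow_add, pow_add]
  field_simp
  ring

theorem slotCoef_top {N : ℕ} (hN : 1 ≤ N) : slotCoef N (N + 1) = 1 := by
  have h1 : qInt (2 * N) ≠ 0 := qInt_ne_zero (by omega)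
  rw [slotCoef_of_two_le (by omega), Nat.add_sub_cancel, div_mul_eq_mul_div, ← qInt_two_mul,
    div_self h1]

/-- The coefficient of `desc N 0 * (E_1 ⋯ E_j)` in the recursion for the projections. -/
def tailCoef (N j : ℕ) : K := qInt N / qInt (2 * N) * (qInt (N + 1 - j) / qInt (N + 1))

theorem tailCoef_zero {N s : ℕ} (hs : s ≤ 1) : tailCoef N 0 = slotCoef N s := by
  have h1 : qInt (N + 1) ≠ 0 := qInt_ne_zero (by omega)
  rw [slotCoef_of_le_one hs, tailCoef, Nat.sub_zero, div_self h1, mul_one]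

/-- Thanks to this zero the sum of tails may run one step too far, so that the recurrence has no
exception at the end. In `TL N` the factor `gen (N + 1)` of that extra tail wraps around to `gen 0`,
which does no harm. -/
theorem tailCoef_top (N : ℕ) : tailCoef N (N + 1) = 0 := by
  rw [tailCoef, Nat.sub_self, qInt_zero, zero_div, mul_zero]

theorem tailCoef_recurrence {N j : ℕ} (h : j + 1 ≤ N) :
    tailCoef N j - qInt 2 * tailCoef N (j + 1) + tailCoef N (j + 2) = 0 := by
  have h1 := qInt_recurrence (N - (j + 1))
  have h2 : tailCoef N j - qInt 2 * tailCoef N (j + 1) + tailCoef N (j + 2) =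
      qInt N / qInt (2 * N) / qInt (N + 1) *
        (qInt (N - (j + 1)) - qInt 2 * qInt (N - (j + 1) + 1) + qInt (N - (j + 1) + 2)) := by
    rw [tailCoef, tailCoef, tailCoef, show N + 1 - j = N - (j + 1) + 2 by omega,
      show N + 1 - (j + 1) = N - (j + 1) + 1 by omega, show N + 1 - (j + 2) = N - (j + 1) by omega]
    ring
  rw [h2, h1, mul_zero]

/-! ### The recursion for the projections -/

/-- The product `E_1 E_2 ⋯ E_j`. -/
def asc : ℕ → TL n
  | 0 => 1
  | j + 1 => asc j * gen (j + 1)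

/-- The product `E_N ⋯ E_2 E_0 E_1 E_2 ⋯ E_j`. -/
def tail (N j : ℕ) : TL n := desc N 0 * asc j

theorem tail_zero (N : ℕ) : (tail N 0 : TL n) = desc N 0 := by rw [tail, asc, mul_one]

theorem tail_succ (N j : ℕ) : (tail N (j + 1) : TL n) = tail N j * gen (j + 1) := by
  rw [tail, asc, tail, mul_assoc]

theorem tail_mul_self (N : ℕ) {j : ℕ} (hj : 1 ≤ j) :
    (tail N j : TL n) * gen j = (-qInt 2) • tail N j := by
  obtain ⟨j, rfl⟩ : ∃ i, j = i + 1 := ⟨j - 1, by omega⟩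
  rw [tail_succ, mul_assoc, gen_sq, mul_smul_comm]

theorem tail_succ_mul {N j : ℕ} (hj : 1 ≤ j) (hjn : j + 1 ≤ n) :
    (tail N (j + 1) : TL n) * gen j = tail N j := by
  obtain ⟨j, rfl⟩ : ∃ i, j = i + 1 := ⟨j - 1, by omega⟩
  rw [tail_succ, tail_succ, mul_assoc, mul_assoc, ← mul_assoc (gen (j + 1)),
    gen_braid (by unfold Adj; omega) (by omega) hjn]

/-- The factor `Q_{n+1} = Q_n * stepFactor n`. -/
def stepFactor (n : ℕ) : TL (n + 1) :=
  ∑ s ∈ Finset.range (n + 3), slotCoef (n + 1) s • desc (n + 1) s +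
    ∑ j ∈ Finset.Icc 1 (n + 2), tailCoef (n + 1) j • tail (n + 1) j

/-! ### The step factor is annihilated from the right by all generators -/

section annihilation

variable {X : TL (n + 1)}

/-- `E_k` crosses the product as a generator of the smaller algebra, which `X` kills. -/
theorem mul_desc_mul_far (hX : ∀ k ≤ n, X * gen k = 0) {s k : ℕ} (hs : s ≤ n + 2) (hk : k ≤ n + 1)
    (h : Far s k) : X * desc (n + 1) s * gen k = 0 := by
  rw [mul_assoc, desc_mul_far (by omega) le_rfl hs hk h, ← mul_assoc, hX _ (h.shift_le hs hk),
    zero_mul]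

theorem mul_tail_mul_of_lt (hX : ∀ k ≤ n, X * gen k = 0) {j k : ℕ} (hj : 1 ≤ j) (hjk : j + 2 ≤ k)
    (hk : k ≤ n + 1) : X * tail (n + 1) j * gen k = 0 := by
  induction j, hj using Nat.le_induction with
  | base =>
    rw [tail_succ, tail_zero, mul_assoc, mul_assoc, gen_comm (by unfold Adj; omega) (by omega) hk,
      ← mul_assoc, ← mul_assoc, mul_desc_mul_far hX (by omega) hk (by unfold Far Adj; omega),
      zero_mul]
  | succ j hj ih =>
    rw [tail_succ, mul_assoc, mul_assoc, gen_comm (by unfold Adj; omega) (by omega) hk,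
      ← mul_assoc, ← mul_assoc, ih (by omega), zero_mul]

/-- Move `E_k` left to `E_k E_{k+1} E_{k+2} E_k = E_k E_{k+2}`. Then `E_{k+2}` meets a tail ending
in `E_k`, the case of `mul_tail_mul_of_lt`. -/
theorem mul_tail_mul_of_gt (hX : ∀ k ≤ n, X * gen k = 0) {j k : ℕ} (hk : 1 ≤ k) (hkj : k + 2 ≤ j)
    (hj : j ≤ n + 1) : X * tail (n + 1) j * gen k = 0 := by
  induction j, hkj using Nat.le_induction with
  | base =>
    rw [tail_succ, mul_assoc, mul_assoc, gen_comm (by unfold Adj; omega) (by omega) (by omega),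
      ← mul_assoc (tail _ _), tail_succ_mul hk (by omega), ← mul_assoc,
      mul_tail_mul_of_lt hX hk le_rfl hj]
  | succ j hkj ih =>
    rw [tail_succ, mul_assoc, mul_assoc, gen_comm (by unfold Adj; omega) (by omega) (by omega),
      ← mul_assoc, ← mul_assoc, ih (by omega), zero_mul]

theorem tail_one_mul_zero : (tail (n + 1) 1 : TL (n + 1)) * gen 0 = (-qInt 2) • tail (n + 1) 1 := by
  rw [tail_succ, tail_zero, mul_assoc, gen_comm (by unfold Adj; omega) (by omega) (by omega),
    ← mul_assoc, desc_mul_self (by omega) (by omega), smul_mul_assoc]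

theorem tail_two_mul_zero (hn : 1 ≤ n) :
    (tail (n + 1) 2 : TL (n + 1)) * gen 0 = tail (n + 1) 1 := by
  have h1 : (desc (n + 1) 2 : TL (n + 1)) * gen 0 = desc (n + 1) 0 :=
    desc_mul_adj (by omega) le_rfl (by omega) (by omega) (by unfold Adj; omega)
  have h2 : (gen 0 : TL (n + 1)) * gen 1 = gen 1 * gen 0 :=
    gen_comm (by unfold Adj; omega) (by omega) (by omega)
  have h3 : (gen 0 : TL (n + 1)) * gen 2 * gen 0 = gen 0 :=
    gen_braid (by unfold Adj; omega) (by omega) (by omega)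
  rw [tail_succ, tail_succ, tail_zero, ← h1]
  calc (desc (n + 1) 2 : TL (n + 1)) * gen 0 * gen 1 * gen 2 * gen 0
      = desc (n + 1) 2 * (gen 0 * gen 1) * gen 2 * gen 0 := by simp only [mul_assoc]
    _ = desc (n + 1) 2 * gen 1 * (gen 0 * gen 2 * gen 0) := by rw [h2]; simp only [mul_assoc]
    _ = desc (n + 1) 2 * gen 0 * gen 1 := by rw [h3, mul_assoc, ← h2, mul_assoc]

theorem mul_tail_mul_zero (hX : ∀ k ≤ n, X * gen k = 0) {j : ℕ} (hj : 3 ≤ j)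
    (hjn : j ≤ n + 1) : X * tail (n + 1) j * gen 0 = 0 := by
  induction j, hj using Nat.le_induction with
  | base =>
    rw [tail_succ, mul_assoc, mul_assoc, gen_comm (by unfold Adj; omega) (by omega) (by omega),
      ← mul_assoc (tail _ _), tail_two_mul_zero (by omega), ← mul_assoc,
      mul_tail_mul_of_lt hX le_rfl le_rfl hjn]
  | succ j hj ih =>
    rw [tail_succ, mul_assoc, mul_assoc, gen_comm (by unfold Adj; omega) (by omega) (by omega),
      ← mul_assoc, ← mul_assoc, ih (by omega), zero_mul]

theorem mul_tail_mul_le_one (hX : ∀ k ≤ n, X * gen k = 0) {j k : ℕ} (hk : k ≤ 1) (hj : 3 ≤ j)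
    (hjn : j ≤ n + 1) : X * tail (n + 1) j * gen k = 0 := by
  obtain rfl | rfl : k = 0 ∨ k = 1 := by omega
  · exact mul_tail_mul_zero hX hj hjn
  · exact mul_tail_mul_of_gt hX le_rfl hj hjn

theorem tail_one_mul {k : ℕ} (hk : k ≤ 1) :
    (tail (n + 1) 1 : TL (n + 1)) * gen k = (-qInt 2) • tail (n + 1) 1 := by
  obtain rfl | rfl : k = 0 ∨ k = 1 := by omega
  · exact tail_one_mul_zero
  · exact tail_mul_self _ le_rfl

theorem tail_two_mul {k : ℕ} (hk : k ≤ 1) (hn : 1 ≤ n) :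
    (tail (n + 1) 2 : TL (n + 1)) * gen k = tail (n + 1) 1 := by
  obtain rfl | rfl : k = 0 ∨ k = 1 := by omega
  · exact tail_two_mul_zero hn
  · exact tail_succ_mul le_rfl (by omega)

theorem desc_mul_clash {k : ℕ} (hk : k ≤ 1) :
    (desc (n + 1) (1 - k) : TL (n + 1)) * gen k = tail (n + 1) 1 := by
  obtain rfl | rfl : k = 0 ∨ k = 1 := by omega
  · have h1 : ∀ k ≤ 1, (desc (n + 1) 2 : TL (n + 1)) * gen k = desc (n + 1) k := fun k hk =>
      desc_mul_adj (by omega) le_rfl (by omega) (by omega) (by unfold Adj; omega)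
    rw [tail_succ, tail_zero, ← h1 0 (by omega), ← h1 (1 - 0) (by omega), mul_assoc, mul_assoc,
      gen_comm (by unfold Adj; omega) (by omega) (by omega)]
  · rw [tail_succ, tail_zero]

/-- The slots `k` and `2` cancel. The slot `1 - k` leaves a multiple of a product ending in `E_0
E_1`, which no other `desc` can cancel; the tails exist to remove it. -/
theorem sum_desc_le_one (hX : ∀ k ≤ n, X * gen k = 0) {k : ℕ} (hk : k ≤ 1) :
    ∑ s ∈ Finset.range (n + 3), slotCoef (n + 1) s • (X * desc (n + 1) s * gen k) =
      tailCoef (n + 1) 0 • (X * tail (n + 1) 1) := by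
  have hsub : ({k, 1 - k, 2} : Finset ℕ) ⊆ Finset.range (n + 3) := by
    intro x hx
    simp only [Finset.mem_insert, Finset.mem_singleton, Finset.mem_range] at hx ⊢
    omega
  rw [← Finset.sum_subset hsub, Finset.sum_insert, Finset.sum_insert, Finset.sum_singleton]
  · have h1 : slotCoef (n + 1) 1 = slotCoef (n + 1) k := by
      rw [slotCoef_of_le_one hk, slotCoef_of_le_one le_rfl]
    rw [mul_assoc X, desc_mul_self (by omega) (by omega), mul_assoc X, desc_mul_clash hk,
      mul_assoc X, desc_mul_adj (s := 2) (by omega) le_rfl (by omega) (by omega)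
        (by unfold Adj; omega), slotCoef_two, h1, tailCoef_zero (s := 1 - k) (by omega),
      mul_smul_comm, smul_smul, add_left_comm, ← add_smul,
      show slotCoef (n + 1) k * -qInt 2 + qInt 2 * slotCoef (n + 1) k = 0 by ring, zero_smul,
      add_zero]
  · simp; omega
  · simp; omega
  · intro s hs hs'
    simp only [Finset.mem_insert, Finset.mem_singleton, Finset.mem_range] at hs hs'
    rw [mul_desc_mul_far hX (by omega) (by omega) (by unfold Far Adj; omega), smul_zero]

theorem sum_desc_two (hX : ∀ k ≤ n, X * gen k = 0) (hn : 1 ≤ n) :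
    ∑ s ∈ Finset.range (n + 3), slotCoef (n + 1) s • (X * desc (n + 1) s * gen 2) = 0 := by
  have hsub : ({0, 1, 2, 3} : Finset ℕ) ⊆ Finset.range (n + 3) := by
    intro x hx
    simp only [Finset.mem_insert, Finset.mem_singleton, Finset.mem_range] at hx ⊢
    omega
  have h1 : ∀ s ≤ n + 2, Adj s 2 → (desc (n + 1) s : TL (n + 1)) * gen 2 = desc (n + 1) 2 :=
    fun s hs h => desc_mul_adj (by omega) le_rfl hs (by omega) h
  rw [← Finset.sum_subset hsub, Finset.sum_insert (by simp), Finset.sum_insert (by simp),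
    Finset.sum_insert (by simp), Finset.sum_singleton]
  · rw [mul_assoc X, h1 0 (by omega) (by unfold Adj; omega), mul_assoc X,
      h1 1 (by omega) (by unfold Adj; omega), mul_assoc X, desc_mul_self (by omega) (by omega),
      mul_assoc X, h1 3 (by omega) (by unfold Adj; omega), mul_smul_comm, smul_smul, ← add_smul,
      ← add_smul, ← add_smul]
    have h2 := slotCoef_three (n + 1)
    rw [show slotCoef (n + 1) 0 + (slotCoef (n + 1) 1 + (slotCoef (n + 1) 2 * -qInt 2 +
      slotCoef (n + 1) 3)) = 0 by linear_combination h2, zero_smul]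
  · intro s hs hs'
    simp only [Finset.mem_insert, Finset.mem_singleton, Finset.mem_range] at hs hs'
    rw [mul_desc_mul_far hX (by omega) (by omega) (by unfold Far Adj; omega), smul_zero]

theorem sum_desc_three_le (hX : ∀ k ≤ n, X * gen k = 0) {k : ℕ} (hk : 2 ≤ k) (hkn : k ≤ n) :
    ∑ s ∈ Finset.range (n + 3), slotCoef (n + 1) s • (X * desc (n + 1) s * gen (k + 1)) = 0 := by
  have hsub : ({k, k + 1, k + 2} : Finset ℕ) ⊆ Finset.range (n + 3) := by
    intro x hx
    simp only [Finset.mem_insert, Finset.mem_singleton, Finset.mem_range] at hx ⊢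
    omega
  have h1 : ∀ s ≤ n + 2, Adj s (k + 1) →
      (desc (n + 1) s : TL (n + 1)) * gen (k + 1) = desc (n + 1) (k + 1) :=
    fun s hs h => desc_mul_adj (by omega) le_rfl hs (by omega) h
  rw [← Finset.sum_subset hsub, Finset.sum_insert (by simp), Finset.sum_insert (by simp),
    Finset.sum_singleton]
  · rw [mul_assoc X, h1 k (by omega) (by unfold Adj; omega), mul_assoc X,
      desc_mul_self (by omega) (by omega), mul_assoc X, h1 (k + 2) (by omega) (by unfold Adj; omega),
      mul_smul_comm, smul_smul, ← add_smul, ← add_smul]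
    have h2 := slotCoef_recurrence (N := n + 1) hk
    rw [show slotCoef (n + 1) k + (slotCoef (n + 1) (k + 1) * -qInt 2 +
      slotCoef (n + 1) (k + 2)) = 0 by linear_combination h2, zero_smul]
  · intro s hs hs'
    simp only [Finset.mem_insert, Finset.mem_singleton, Finset.mem_range] at hs hs'
    rw [mul_desc_mul_far hX (by omega) (by omega) (by unfold Far Adj; omega), smul_zero]

/-- The recurrence at `j = 0`, with the absent term `tailCoef (n + 1) 0` moved to the other side. -/
theorem sum_tail_le_one (hX : ∀ k ≤ n, X * gen k = 0) {k : ℕ} (hk : k ≤ 1) :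
    ∑ j ∈ Finset.Icc 1 (n + 2), tailCoef (n + 1) j • (X * tail (n + 1) j * gen k) =
      -(tailCoef (n + 1) 0 • (X * tail (n + 1) 1)) := by
  have hsub : ({1, 2} : Finset ℕ) ⊆ Finset.Icc 1 (n + 2) := by
    intro x hx
    simp only [Finset.mem_insert, Finset.mem_singleton, Finset.mem_Icc] at hx ⊢
    omega
  rw [← Finset.sum_subset hsub, Finset.sum_insert (by simp), Finset.sum_singleton]
  · have h2 : tailCoef (n + 1) 2 • (X * tail (n + 1) 2 * gen k) =
        tailCoef (n + 1) 2 • (X * tail (n + 1) 1) := by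
      rcases Nat.eq_zero_or_pos n with rfl | hn
      · rw [tailCoef_top, zero_smul, zero_smul]
      · rw [mul_assoc, tail_two_mul hk hn]
    have h3 := tailCoef_recurrence (N := n + 1) (j := 0) (by omega)
    rw [h2, mul_assoc X, tail_one_mul hk, mul_smul_comm, smul_smul, ← add_smul, ← neg_smul]
    congr 1
    linear_combination h3
  · intro j hj hj'
    simp only [Finset.mem_insert, Finset.mem_singleton, Finset.mem_Icc] at hj hj'
    rcases eq_or_ne j (n + 2) with rfl | h
    · rw [tailCoef_top, zero_smul]
    · rw [mul_tail_mul_le_one hX hk (by omega) (by omega), smul_zero]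

theorem sum_tail_two_le (hX : ∀ k ≤ n, X * gen k = 0) {k : ℕ} (hk : 1 ≤ k) (hkn : k ≤ n) :
    ∑ j ∈ Finset.Icc 1 (n + 2), tailCoef (n + 1) j • (X * tail (n + 1) j * gen (k + 1)) = 0 := by
  have hsub : ({k, k + 1, k + 2} : Finset ℕ) ⊆ Finset.Icc 1 (n + 2) := by
    intro x hx
    simp only [Finset.mem_insert, Finset.mem_singleton, Finset.mem_Icc] at hx ⊢
    omega
  rw [← Finset.sum_subset hsub, Finset.sum_insert (by simp), Finset.sum_insert (by simp),
    Finset.sum_singleton]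
  · have h2 : tailCoef (n + 1) (k + 2) • (X * tail (n + 1) (k + 2) * gen (k + 1)) =
        tailCoef (n + 1) (k + 2) • (X * tail (n + 1) (k + 1)) := by
      rcases eq_or_ne k n with rfl | hn
      · rw [tailCoef_top, zero_smul, zero_smul]
      · rw [mul_assoc, tail_succ_mul (by omega) (by omega)]
    have h3 := tailCoef_recurrence (N := n + 1) (j := k) (by omega)
    rw [h2, mul_assoc X, ← tail_succ, mul_assoc X, tail_mul_self _ (by omega), mul_smul_comm,
      smul_smul, ← add_smul, ← add_smul]
    rw [show tailCoef (n + 1) k + (tailCoef (n + 1) (k + 1) * -qInt 2 +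
      tailCoef (n + 1) (k + 2)) = 0 by linear_combination h3, zero_smul]
  · intro j hj hj'
    simp only [Finset.mem_insert, Finset.mem_singleton, Finset.mem_Icc] at hj hj'
    rcases eq_or_ne j (n + 2) with rfl | h
    · rw [tailCoef_top, zero_smul]
    · rcases Nat.lt_or_ge j k with h1 | h1
      · rw [mul_tail_mul_of_lt hX (by omega) (by omega) (by omega), smul_zero]
      · rw [mul_tail_mul_of_gt hX (by omega) (by omega) (by omega), smul_zero]

theorem mul_stepFactor_mul_gen (hX : ∀ k ≤ n, X * gen k = 0) {k : ℕ} (hk : k ≤ n + 1) :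
    X * stepFactor n * gen k = 0 := by
  have h : X * stepFactor n * gen k =
      ∑ s ∈ Finset.range (n + 3), slotCoef (n + 1) s • (X * desc (n + 1) s * gen k) +
        ∑ j ∈ Finset.Icc 1 (n + 2), tailCoef (n + 1) j • (X * tail (n + 1) j * gen k) := by
    simp only [stepFactor, mul_add, add_mul, Finset.mul_sum, Finset.sum_mul, mul_smul_comm,
      smul_mul_assoc]
  rw [h]
  rcases Nat.lt_or_ge 1 k with h1 | h1
  · obtain ⟨k, rfl⟩ : ∃ m, k = m + 1 := ⟨k - 1, by omega⟩
    rw [sum_tail_two_le hX (by omega) (by omega), add_zero]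
    rcases eq_or_ne k 1 with rfl | h2
    · exact sum_desc_two hX (by omega)
    · exact sum_desc_three_le hX (by omega) (by omega)
  · rw [sum_desc_le_one hX h1, sum_tail_le_one hX h1, add_neg_cancel]

end annihilation

/-! ### Existence and uniqueness of the projections -/

/-- The homomorphism to the ground field that sends all generators to zero. -/
def aug (n : ℕ) : TL n →ₐ[K] K :=
  lift (fun _ => 0) (fun _ => by simp) (fun _ _ _ => by simp) (fun _ _ _ => by simp)

theorem aug_E (i : Fin (n + 1)) : aug n (E i) = 0 := lift_E _ _ _ _

theorem aug_gen (k : ℕ) : aug n (gen k) = 0 := aug_E _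

theorem aug_incl {m : ℕ} (h : m ≤ n) (x : TL m) : aug n (incl h x) = aug m x := by
  have : (aug n).comp (incl h) = aug m := algHom_ext fun i => by
    rw [AlgHom.comp_apply, incl_E, aug_E, aug_E]
  exact DFunLike.congr_fun this x

theorem incl_self (x : TL n) : incl le_rfl x = x := by
  have : incl le_rfl = AlgHom.id K (TL n) := algHom_ext fun i => by
    rw [incl_E]; rfl
  exact DFunLike.congr_fun this x

theorem mul_eq_aug_smul {X : TL n} (hX : ∀ i, X * E i = 0) (y : TL n) :
    X * y = aug n y • X := by
  induction y using TL_induction with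
  | h1 r => rw [AlgHom.commutes, Algebra.algebraMap_eq_smul_one, mul_smul_comm, mul_one]; rfl
  | hE i => rw [hX, aug_E, zero_smul]
  | hm y z hy hz => rw [← mul_assoc, hy, smul_mul_assoc, hz, map_mul, smul_smul]
  | ha y z hy hz => rw [mul_add, hy, hz, map_add, add_smul]

theorem mul_eq_aug_smul' {X : TL n} (hX : ∀ i, E i * X = 0) (y : TL n) :
    y * X = aug n y • X := by
  induction y using TL_induction with
  | h1 r => rw [AlgHom.commutes, Algebra.algebraMap_eq_smul_one, smul_mul_assoc, one_mul]; rfl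
  | hE i => rw [hX, aug_E, zero_smul]
  | hm y z hy hz => rw [mul_assoc, hz, mul_smul_comm, hy, map_mul, smul_smul, mul_comm]
  | ha y z hy hz => rw [add_mul, hy, hz, map_add, add_smul]

/-- The anti-automorphism that fixes all generators. -/
def star (n : ℕ) : TL n →ₐ[K] (TL n)ᵐᵒᵖ :=
  lift (fun i => MulOpposite.op (E i))
    (fun i => by rw [← MulOpposite.op_mul, E_sq, MulOpposite.op_smul])
    (fun i j h => by
      rw [← MulOpposite.op_mul, ← MulOpposite.op_mul, ← mul_assoc, E_braid h])
    (fun i j h => by rw [← MulOpposite.op_mul, ← MulOpposite.op_mul, E_comm h])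

theorem star_E (i : Fin (n + 1)) : star n (E i) = MulOpposite.op (E i) := lift_E _ _ _ _

theorem aug_star (x : TL n) : aug n (star n x).unop = aug n x := by
  induction x using TL_induction with
  | h1 r => simp
  | hE i => rw [star_E]; rfl
  | hm y z hy hz => rw [map_mul, MulOpposite.unop_mul, map_mul, map_mul, hy, hz, mul_comm]
  | ha y z hy hz => rw [map_add, MulOpposite.unop_add, map_add, map_add, hy, hz]

/-- Evaluate `X * star X` from both sides. Right annihilation of `X` gives `X`, left annihilation of
`star X` gives `star X`; so `X` is fixed by the anti-automorphism. -/
theorem E_mul_of_mul_E {X : TL n} (hX : ∀ i, X * E i = 0) (h1 : aug n X = 1) (i : Fin (n + 1)) :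
    E i * X = 0 := by
  have h2 : ∀ i, E i * (star n X).unop = 0 := by
    intro i
    have := congrArg MulOpposite.unop (congrArg (star n) (hX i))
    simpa [star_E] using this
  have h3 := mul_eq_aug_smul hX (star n X).unop
  rw [mul_eq_aug_smul' h2 X, aug_star, h1, one_smul, one_smul] at h3
  rw [← h3]
  exact h2 i

/-- The Jones–Wenzl projections, defined recursively. -/
def jonesWenzl : ∀ n, TL n
  | 0 => 1 + (qInt 2)⁻¹ • gen 0
  | n + 1 => up (jonesWenzl n) * stepFactor n

theorem aug_desc {M s : ℕ} (hM : 1 ≤ M) (hs : s ≤ M) : aug n (desc M s) = 0 := by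
  obtain ⟨y, hy⟩ := desc_eq_top_mul (n := n) hM hs
  rw [hy, map_mul, aug_gen, zero_mul]

theorem aug_stepFactor (n : ℕ) : aug (n + 1) (stepFactor n) = 1 := by
  have h1 : ∀ s ∈ Finset.range (n + 2),
      slotCoef (n + 1) s • aug (n + 1) (desc (n + 1) s) = 0 := fun s hs => by
    rw [aug_desc (by omega) (by have := Finset.mem_range.1 hs; omega), smul_zero]
  have h2 : ∀ j ∈ Finset.Icc 1 (n + 2),
      tailCoef (n + 1) j • aug (n + 1) (tail (n + 1) j) = 0 := fun j _ => by
    rw [tail, map_mul, aug_desc (by omega) (by omega), zero_mul, smul_zero]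
  simp only [stepFactor, map_add, map_sum, map_smul]
  rw [Finset.sum_eq_zero h2, Finset.sum_range_succ, Finset.sum_eq_zero h1,
    desc_of_lt (by omega), map_one, slotCoef_top (by omega), zero_add, add_zero, smul_eq_mul,
    mul_one]

theorem aug_jonesWenzl (n : ℕ) : aug n (jonesWenzl n) = 1 := by
  induction n with
  | zero => rw [jonesWenzl, map_add, map_one, map_smul, aug_gen, smul_zero, add_zero]
  | succ n ih => rw [jonesWenzl, map_mul, aug_incl, ih, aug_stepFactor, mul_one]

theorem jonesWenzl_mul_gen {k : ℕ} (hk : k ≤ n) : jonesWenzl n * gen k = 0 := by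
  induction n generalizing k with
  | zero =>
    obtain rfl : k = 0 := by omega
    rw [jonesWenzl, add_mul, one_mul, smul_mul_assoc, gen_sq, smul_smul, mul_neg,
      inv_mul_cancel₀ (qInt_ne_zero two_ne_zero), neg_smul, one_smul, add_neg_cancel]
  | succ n ih =>
    exact mul_stepFactor_mul_gen (fun k hk => by
      rw [← up_gen hk, ← map_mul, ih hk, map_zero]) hk

theorem jonesWenzl_mul_E (i : Fin (n + 1)) : jonesWenzl n * E i = 0 := by
  rw [E_eq_gen]; exact jonesWenzl_mul_gen (by omega)

theorem E_mul_jonesWenzl (i : Fin (n + 1)) : E i * jonesWenzl n = 0 :=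
  E_mul_of_mul_E jonesWenzl_mul_E (aug_jonesWenzl n) i

theorem isJonesWenzl_jonesWenzl : IsJonesWenzl jonesWenzl where
  ne_zero n h := by
    have := aug_jonesWenzl n
    rw [h, map_zero] at this
    exact zero_ne_one this
  mul_incl i n h := by
    rw [mul_eq_aug_smul jonesWenzl_mul_E, aug_incl, aug_jonesWenzl, one_smul]
  incl_mul i n h := by
    rw [mul_eq_aug_smul' E_mul_jonesWenzl, aug_incl, aug_jonesWenzl, one_smul]
  E_mul _ i := E_mul_jonesWenzl i
  mul_E _ i := jonesWenzl_mul_E i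

/-- Idempotency and `Q n ≠ 0` force augmentation `1`; then the product of the two candidates equals
each of them. -/
theorem IsJonesWenzl.eq_jonesWenzl {Q : ∀ n, TL n} (hQ : IsJonesWenzl Q) : Q = jonesWenzl := by
  funext n
  have h1 := hQ.mul_incl n n le_rfl
  rw [incl_self, mul_eq_aug_smul (hQ.mul_E n)] at h1
  have h2 : aug n (Q n) = 1 := by
    have h3 : (aug n (Q n) - 1) • Q n = 0 := by rw [sub_smul, h1, one_smul, sub_self]
    exact sub_eq_zero.1 ((smul_eq_zero.1 h3).resolve_right (hQ.ne_zero n))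
  have h4 := mul_eq_aug_smul (hQ.mul_E n) (jonesWenzl n)
  rw [mul_eq_aug_smul' E_mul_jonesWenzl, h2, aug_jonesWenzl, one_smul, one_smul] at h4
  exact h4.symm

/-! ### The recursion for the coefficients -/

theorem diag_mul_eq_zero {x : TL n} (hx : diag x = 0) (y : TL n) : diag (x * y) = 0 := by
  have h : diag (x * y) = (diagHom n y).unop (diag x) := by simp [diag]
  rw [h, hx, map_zero]

theorem diag_sum {ι : Type*} (s : Finset ι) (f : ι → TL n) :
    diag (∑ i ∈ s, f i) = ∑ i ∈ s, diag (f i) := by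
  simp [diag]

/-- After `desc (n + 1) 0` there is a dotted cap at position 1, and the next factor `E_1` closes it
to a dotted loop. -/
theorem diag_mul_tail {x : TL (n + 1)} {v : DiagModule n} (hx : diag x = insL (n + 2) v) {j : ℕ}
    (hj : 1 ≤ j) : diag (x * tail (n + 1) j) = 0 := by
  induction j, hj using Nat.le_induction with
  | base =>
    rw [tail_succ, tail_zero, ← mul_assoc, diag_mul_gen (by omega),
      diag_mul_desc (by omega) le_rfl (by omega) hx, actL_insL_clash (by omega)]
  | succ j hj ih => rw [tail_succ, ← mul_assoc, diag_mul_eq_zero ih]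

theorem diag_mul_stepFactor {x : TL (n + 1)} {v : DiagModule n} (hx : diag x = insL (n + 2) v) :
    diag (x * stepFactor n) =
      ∑ s ∈ Finset.range (n + 3), slotCoef (n + 1) s • insL s v := by
  rw [stepFactor, mul_add, diag_add, Finset.mul_sum, Finset.mul_sum, diag_sum, diag_sum,
    Finset.sum_eq_zero (s := Finset.Icc 1 (n + 2)), add_zero]
  · refine Finset.sum_congr rfl fun s hs => ?_
    rw [Finset.mem_range] at hs
    rw [mul_smul_comm, diag_smul, diag_mul_desc (by omega) le_rfl (by omega) hx]
  · intro j hj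
    rw [mul_smul_comm, diag_smul, diag_mul_tail hx (Finset.mem_Icc.1 hj).1, smul_zero]

theorem diag_gen_zero : diag (gen 0 : TL 0) = 0 := by
  have := diag_mul_gen (n := 0) le_rfl 1
  rw [one_mul] at this
  rw [this, actL_diagram_zero le_rfl]

/-- In this case the step factor is `(1 + E_0 / [2]) (1 + E_1 / [2])`, whose first factor `E_0`
kills. -/
theorem gen_zero_mul_stepFactor : (gen 0 : TL 1) * stepFactor 0 = 0 := by
  have h2 : qInt 2 ≠ 0 := qInt_ne_zero two_ne_zero
  have h3 : ∑ j ∈ Finset.Icc 1 (0 + 2), tailCoef (0 + 1) j • (tail (0 + 1) j : TL (0 + 1)) =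
      tailCoef 1 1 • (gen 0 * gen 1) + tailCoef 1 2 • tail 1 2 := by
    rw [Finset.sum_Icc_succ_top (by omega), zero_add, Finset.Icc_self, Finset.sum_singleton,
      tail_succ, tail_zero, desc_one (by omega)]
  have h4 : tailCoef 1 2 = 0 := tailCoef_top 1
  have h5 : slotCoef 1 2 = 1 := slotCoef_top le_rfl
  rw [stepFactor, h3, h4, zero_smul, add_zero, Finset.sum_range_succ, Finset.sum_range_succ,
    Finset.sum_range_one, desc_of_lt (by omega : 0 + 1 < 0 + 2), desc_one zero_le_one,
    desc_one (le_refl 1)]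
  simp only [zero_add, mul_add, mul_smul_comm, ← mul_assoc, gen_sq, mul_one, smul_mul_assoc, h5,
    slotCoef_of_le_one (N := 1) zero_le_one, slotCoef_of_le_one (N := 1) le_rfl, tailCoef, qInt_one,
    Nat.add_sub_cancel, smul_smul, one_smul]
  rw [show (1 : K) / qInt (2 * 1) * -qInt 2 = -1 by rw [mul_one]; field_simp,
    show (1 : K) / qInt (2 * 1) * (1 / qInt (1 + 1)) * -qInt 2 = -(1 / qInt (2 * 1)) by
      rw [mul_one, one_add_one_eq_two]; field_simp]
  simp only [neg_smul, one_smul]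
  abel

theorem diag_jonesWenzl_succ (n : ℕ) : diag (jonesWenzl (n + 1)) =
    ∑ s ∈ Finset.range (n + 3), slotCoef (n + 1) s • insL s (diag (jonesWenzl n)) := by
  rw [jonesWenzl]
  cases n with
  | succ n => exact diag_mul_stepFactor (diag_up _)
  -- `diag_up` is not available at level `0`: the term `E_0 / [2]` of `Q_0` has image zero there but
  -- survives inclusion. It is removed by the step factor instead.
  | zero =>
    have h0 : diag (jonesWenzl 0) = diag (1 : TL 0) := by
      rw [jonesWenzl, diag_add, diag_smul, diag_gen_zero, smul_zero, add_zero]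
    rw [h0, ← diag_mul_stepFactor diag_up_one]
    rw [jonesWenzl, map_add, add_mul, map_smul, up_gen le_rfl, smul_mul_assoc, gen_zero_mul_stepFactor, smul_zero,
      add_zero]

open Classical in
theorem insL_apply {s : ℕ} (hs : s ≤ n + 2) (v : DiagModule n) (D : EvenDiagram (n + 1)) :
    insL s v D = if h : D.1.HasSlot s then v ⟨del s D.1, D.2.del hs h⟩ else 0 := by
  rw [insL, Finsupp.lmapDomain_apply]
  split_ifs with h
  · have : D = insE s ⟨del s D.1, D.2.del hs h⟩ :=
      Subtype.ext (by rw [insE_val hs, ins_del hs D.2.isDotted h])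
    conv_lhs => rw [this]
    exact Finsupp.mapDomain_apply (insE_injective s) _ _
  · refine Finsupp.mapDomain_of_notMem_range _ _ ?_
    rintro ⟨D', rfl⟩
    exact h (hasSlot_insE hs D')

theorem mem_positions_iff {D : Diagram (n + 1)} {i : ℕ} :
    i ∈ D.positions ↔ ∃ s, s ≤ n + 2 ∧ D.HasSlot s ∧ spos s = i := by
  classical
  have hd : D.dottedPositions = if D.HasSlot 0 then {1} else ∅ := by
    rw [dottedPositions]
    congr 1
    simp [HasSlot, spos]
  rw [positions, Finset.mem_union, hd, undottedPositions, Finset.mem_filter, Finset.mem_Icc]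
  constructor
  · rintro (h | ⟨⟨h1, h2⟩, h3, h4⟩)
    · split_ifs at h with h0
      · rw [Finset.mem_singleton] at h
        exact ⟨0, by omega, h0, h.symm⟩
      · simp at h
    · have h5 : spos i = i := by unfold spos; omega
      exact ⟨i, h2, ⟨by rwa [h5], by rw [h5]; exact iff_of_false h4 (by omega)⟩, h5⟩
  · rintro ⟨s, hs, h, rfl⟩
    rcases Nat.eq_zero_or_pos s with rfl | hs0
    · left; rw [if_pos h]; simp [spos]
    · right
      exact ⟨⟨one_le_spos s, by unfold spos; omega⟩, h.1, fun h1 => by have := h.2.1 h1; omega⟩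

theorem reduce_spos {D : Diagram (n + 1)} {s : ℕ} (h : D.HasSlot s) :
    D.reduce (spos s) = del s D := by
  classical
  rw [reduce, del, twist]
  congr 1
  have hd : 1 ∈ D.dottedPositions ↔ D.HasCap 1 ∧ D.DottedAt 1 := by
    rw [dottedPositions]; split_ifs with h1 <;> simp [h1]
  rw [eq_iff_iff]
  constructor
  · rintro ⟨h1, h2⟩
    have h3 := h.2
    rw [h1] at h2 h3
    exact h3.1 (hd.1 h2).2
  · rintro rfl
    exact ⟨rfl, hd.2 ⟨h.1, h.2.2 rfl⟩⟩

theorem eq_of_spos_eq {D : Diagram n} {s t : ℕ} (hs : D.HasSlot s) (ht : D.HasSlot t)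
    (h : spos s = spos t) : s = t := by
  have h1 := hs.2
  have h2 := ht.2
  rw [h] at h1
  have h3 := h1.symm.trans h2
  unfold spos at h
  omega

open Classical in
/-- The coefficient of a diagram in the Jones–Wenzl projection; it is zero for diagrams which are
not even. -/
def coefJW (n : ℕ) (D : Diagram n) : K :=
  if h : D.IsEven then diag (jonesWenzl n) ⟨D, h⟩ else 0

theorem coefJW_of_isEven {D : Diagram n} (h : D.IsEven) :
    coefJW n D = diag (jonesWenzl n) ⟨D, h⟩ := dif_pos h

theorem coefJW_succ {D : Diagram (n + 1)} (hD : D.IsEven) :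
    coefJW (n + 1) D = ∑ i ∈ D.positions, coefG (n + 1) i * coefJW n (D.reduce i) := by
  classical
  have hpos : D.positions = ((Finset.range (n + 3)).filter D.HasSlot).image spos := by
    ext i
    rw [mem_positions_iff]
    simp only [Finset.mem_image, Finset.mem_filter, Finset.mem_range, Nat.lt_succ_iff, and_assoc]
  rw [hpos, Finset.sum_image, Finset.sum_filter, coefJW_of_isEven hD, diag_jonesWenzl_succ,
    Finsupp.finsetSum_apply]
  · refine Finset.sum_congr rfl fun s hs => ?_
    have hs : s ≤ n + 2 := by rw [Finset.mem_range] at hs; omega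
    rw [Finsupp.smul_apply, insL_apply hs, smul_eq_mul]
    split_ifs with h
    · rw [reduce_spos h, coefJW_of_isEven (hD.del hs h)]; rfl
    · rw [mul_zero]
  · intro s hs t ht h
    simp only [Finset.coe_filter, Set.mem_ofPred_eq] at hs ht
    exact eq_of_spos_eq hs.2 ht.2 h

theorem isEven_reduce {D : Diagram (n + 1)} (hD : D.IsEven) {i : ℕ} (hi : i ∈ D.positions) :
    (D.reduce i).IsEven := by
  obtain ⟨s, hs, h, rfl⟩ := mem_positions_iff.1 hi
  rw [reduce_spos h]
  exact hD.del hs h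

end TypeD

end

/-! ### The theorem -/

theorem mainTheorem7 :
    (∃! Q : ∀ n, TypeD.TL n, TypeD.IsJonesWenzl Q) ∧
    ∀ Q : ∀ n, TypeD.TL n, TypeD.IsJonesWenzl Q →
      ∃ coef : ∀ n : ℕ, TypeD.Diagram n → TypeD.K,
        (∀ (n : ℕ) (D : TypeD.Diagram n), D.IsEven →
          ∀ r : TypeD.K, TypeD.IsCoef (Q n) D r ↔ r = coef n D) ∧
        ∀ (n : ℕ) (D : TypeD.Diagram (n + 1)), D.IsEven →
          (∀ i ∈ D.positions, (D.reduce i).IsEven) ∧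
          coef (n + 1) D =
            ∑ i ∈ D.positions, TypeD.coefG (n + 1) i * coef n (D.reduce i) := by
  refine ⟨⟨TypeD.jonesWenzl, TypeD.isJonesWenzl_jonesWenzl, fun Q hQ => hQ.eq_jonesWenzl⟩, ?_⟩
  intro Q hQ
  obtain rfl := hQ.eq_jonesWenzl
  refine ⟨TypeD.coefJW, fun n D hD r => ?_, fun n D hD =>
    ⟨fun i hi => TypeD.isEven_reduce hD hi, TypeD.coefJW_succ hD⟩⟩
  rw [TypeD.coefJW_of_isEven hD]
  exact TypeD.isCoef_iff (TypeD.jonesWenzl n) ⟨D, hD⟩ r
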